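/- All Hilbert spaces are finite-dimensional and complex, $\log$ is the binary logarithm, a \emph{state} is a positive semi-definite operator of trace one, and a TP-CPM is a trace-preserving completely positive linear map on operators. Entropies take values in $[-\infty,\infty]$. Let $\rho_{AB}$ be a state on $\mathcal H_A\otimes\mathcal H_B$ and $\sigma_B$ a state on $\mathcal H_B$. For $\alpha\in(0,1)\cup(1,\infty)$ put \[ H_\alpha(A|B)_{\rho|\sigma}:=\frac{1}{1-\alpha}\log\operatorname{tr}\bigl(\rho_{AB}^{\alpha}\,(\mathbb 1_A\otimes\sigma_B)^{1-\alpha}\bigr) \] if $\sigma_B$ is invertible, and $H_\alpha(A|B)_{\rho|\sigma}:=\lim_{\xi\downarrow 0}H_\alpha(A|B)_{\rho|\sigma+\xi\mathbb 1}$ otherwise, where $H_\alpha(A|B)_{\rho|\sigma+\xi\mathbb 1}$ is given by the same formula. Put $H_0(A|B)_{\rho|\sigma}:=\lim_{\alpha\downarrow0}H_\alpha(A|B)_{\rho|\sigma}$, $H_1(A|B)_{\rho|\sigma}:=\lim_{\alpha\to1}H_\alpha(A|B)_{\rho|\sigma}$, and \[ H(A|B)_{\rho|\sigma}:=\lim_{\xi\downarrow0}\operatorname{tr}\bigl(\rho_{AB}(\mathbb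 1_A\otimes\log(\sigma_B+\xi\mathbb 1_B)-\log\rho_{AB})\bigr). \] \textbf{Lemma.} \begin{enumerate} \item All these limits exist in $[-\infty,\infty]$, $H_\alpha(A|B)_{\rho|\sigma}=\lim_{\xi\downarrow0}H_\alpha(A|B)_{\rho|\sigma+\xi\mathbb 1}$ for every $\alpha\in(0,1)\cup(1,\infty)$ and every $\sigma_B$ (invertible or not), and $H_1(A|B)_{\rho|\sigma}=H(A|B)_{\rho|\sigma}$. \item (Data processing.) Let $\alpha\in[0,2]$, let $\mathcal E$ be a TP-CPM from operators on $\mathcal H_B$ to operators on $\mathcal H_C$, and let $\tau_{AC}=(\mathcal I\otimes\mathcal E)(\rho_{AB})$ and $\omega_C=\mathcal E(\sigma_B)$, where $\mathcal I$ is the identity map on operators on $\mathcal H_A$. Then \[ H_\alpha(A|B)_{\rho|\sigma}\le H_\alpha(A|C)_{\tau|\omega}. \] \item (Strong subadditivity.) Let $\rho_{ABC}$ be a state with marginals $\rho_{AB},\rho_{BC},\rho_B$, and let $S(\rho)=-\operatorname{tr}(\rho\log\rho)$. Then $H(A|BC)_{\rho|\rho}=S(\rho_{ABC})-S(\rho_{BC})$,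 $H(A|B)_{\rho|\rho}=S(\rho_{AB})-S(\rho_B)$ and $H(A|BC)_{\rho|\rho}\le H(A|B)_{\rho|\rho}$, where the second $\rho$ in the subscript stands for the marginal on the conditioning system; equivalently \[ S(\rho_{ABC})+S(\rho_B)\le S(\rho_{AB})+S(\rho_{BC}). \] \end{enumerate} -/

import Mathlib

open Filter Topology
open scoped Kronecker ComplexOrder

noncomputable section

namespace QuantumEntropy

/-! Finite-dimensional Hilbert spaces are `ℂ^A`, `ℂ^B`, … for finite index types `A`, `B`, …;
operators are complex matrices and `ℂ^A ⊗ ℂ^B` is `ℂ^(A × B)`. Logarithms are binary. -/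

/-- Normalized quantum states: positive semi-definite operators of trace one. -/
structure IsState {A : Type*} [Fintype A] (ρ : Matrix A A ℂ) : Prop where
  posSemidef : ρ.PosSemidef
  trace_eq_one : ρ.trace = 1

/-- The map `id_A ⊗ E` on operators on `ℂ^A ⊗ ℂ^B`: it applies `E` to every `B`-block. On product
operators it is `X ⊗ Y ↦ X ⊗ E Y`. -/
def ampliation (A : Type*) {B C : Type*}
    (E : Matrix B B ℂ →ₗ[ℂ] Matrix C C ℂ) (X : Matrix (A × B) (A × B) ℂ) :
    Matrix (A × C) (A × C) ℂ :=
  Matrix.of fun p q => E (Matrix.of fun b b' => X (p.1, b) (q.1, b')) p.2 q.2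

/-- Trace-preserving completely positive maps: `E` preserves the trace, and `id ⊗ E` is
positive for an ancilla of every finite dimension. -/
structure IsTPCPM {B C : Type*} [Fintype B] [Fintype C]
    (E : Matrix B B ℂ →ₗ[ℂ] Matrix C C ℂ) : Prop where
  trace_map : ∀ X : Matrix B B ℂ, (E X).trace = X.trace
  completelyPositive : ∀ (k : ℕ) (X : Matrix (Fin k × B) (Fin k × B) ℂ),
    X.PosSemidef → (ampliation (Fin k) E X).PosSemidef

/-- Partial trace over the second tensor factor. -/
def traceSnd (B C : Type*) [Fintype C] :
    Matrix (B × C) (B × C) ℂ →ₗ[ℂ] Matrix B B ℂ where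
  toFun X := Matrix.of fun b b' => ∑ c, X (b, c) (b', c)
  map_add' X Y := by ext; simp [Finset.sum_add_distrib]
  map_smul' r X := by ext; simp [Finset.mul_sum]

/-- Partial trace over the first tensor factor. -/
def traceFst (B C : Type*) [Fintype B] :
    Matrix (B × C) (B × C) ℂ →ₗ[ℂ] Matrix C C ℂ where
  toFun X := Matrix.of fun c c' => ∑ b, X (b, c) (b, c')
  map_add' X Y := by ext; simp [Finset.sum_add_distrib]
  map_smul' r X := by ext; simp [Finset.mul_sum]

/-- Real power of a Hermitian matrix, by functional calculus. -/
def mpow {A : Type*} [Fintype A] [DecidableEq A] (X : Matrix A A ℂ) (s : ℝ) : Matrix A A ℂ :=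
  cfc (fun x : ℝ => x ^ s) X

/-- Binary logarithm of a Hermitian matrix, by functional calculus; zero eigenvalues are sent to
`0`, which realizes the convention `0 log 0 = 0` in `tr (ρ log ρ)`. -/
def mlog {A : Type*} [Fintype A] [DecidableEq A] (X : Matrix A A ℂ) : Matrix A A ℂ :=
  cfc (Real.logb 2) X

/-- The von Neumann entropy `S(ρ) = - tr (ρ log ρ)`. -/
def vonNeumannEntropy {A : Type*} [Fintype A] [DecidableEq A] (ρ : Matrix A A ℂ) : ℝ :=
  -((ρ * mlog ρ).trace).re

section Conditional

variable {A B : Type*} [Fintype A] [Fintype B] [DecidableEq A] [DecidableEq B]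

/-- The expression `1/(1-α) · log tr (ρ_AB^α (1_A ⊗ σ_B)^(1-α))`, for invertible `σ_B`. -/
def alphaEntropyInv (α : ℝ) (ρ : Matrix (A × B) (A × B) ℂ) (σ : Matrix B B ℂ) : ℝ :=
  1 / (1 - α) *
    Real.logb 2 ((mpow ρ α * mpow ((1 : Matrix A A ℂ) ⊗ₖ σ) (1 - α)).trace).re

/-- The `α`-entropy `H_α(A|B)_{ρ|σ}` for `α ∈ (0,1) ∪ (1,∞)`, with values in the extended reals:
the expression above if `σ` is invertible, and its limit along `σ + ξ 1`, `ξ ↓ 0`, otherwise. -/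
def alphaEntropyGeneric (α : ℝ) (ρ : Matrix (A × B) (A × B) ℂ) (σ : Matrix B B ℂ) : EReal :=
  open Classical in
  if IsUnit σ then (alphaEntropyInv α ρ σ : EReal)
  else limUnder (𝓝[>] (0 : ℝ)) fun ξ : ℝ =>
    (alphaEntropyInv α ρ (σ + (ξ : ℂ) • (1 : Matrix B B ℂ)) : EReal)

/-- The conditional `α`-entropy `H_α(A|B)_{ρ|σ}` for `α ∈ [0,∞)`; at `α = 0` and `α = 1` it is the
limit in `α`. -/
def condAlphaEntropy (α : ℝ) (ρ : Matrix (A × B) (A × B) ℂ) (σ : Matrix B B ℂ) : EReal :=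
  open Classical in
  if α = 0 then limUnder (𝓝[>] (0 : ℝ)) fun β : ℝ => alphaEntropyGeneric β ρ σ
  else if α = 1 then limUnder (𝓝[≠] (1 : ℝ)) fun β : ℝ => alphaEntropyGeneric β ρ σ
  else alphaEntropyGeneric α ρ σ

/-- The expression `tr (ρ_AB (1_A ⊗ log σ_B - log ρ_AB))`, for invertible `σ_B`. -/
def condVonNeumannInv (ρ : Matrix (A × B) (A × B) ℂ) (σ : Matrix B B ℂ) : ℝ :=
  ((ρ * ((1 : Matrix A A ℂ) ⊗ₖ mlog σ - mlog ρ)).trace).re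

/-- The conditional von Neumann entropy relative to `σ`,
`H(A|B)_{ρ|σ} = lim_{ξ ↓ 0} tr (ρ_AB (1_A ⊗ log (σ_B + ξ 1) - log ρ_AB))`. -/
def condVonNeumann (ρ : Matrix (A × B) (A × B) ℂ) (σ : Matrix B B ℂ) : EReal :=
  limUnder (𝓝[>] (0 : ℝ)) fun ξ : ℝ =>
    (condVonNeumannInv ρ (σ + (ξ : ℂ) • (1 : Matrix B B ℂ)) : EReal)

end Conditional

end QuantumEntropy

end

set_option linter.unusedSectionVars false

/-! Traces of the form `tr f(ρ) g(M)` with `M = 1 ⊗ σ` are classical sums `∑ w f(p) g(q)` over pairs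
of eigenvalues, weighted by the squared overlaps of the eigenvectors (`trace_cfc_mul_cfc`). Adding
`ξ 1` to `σ` shifts only the `q`, so every limit in the first claim reduces to a limit of real sums
with fixed weights. At `α = 1` the limit is a derivative of `log ∑ w p^α q^(1-α)`, unless part of
the support of `ρ` lies over the kernel of `M`; then it is `⊥`.

Data processing rests on the functional `∑ w · l p q / (q + l p)`, which is the minimum over `Y` of
`tr M Y Y* + l tr ρ (1-Y)* (1-Y)`. An optimal `Y` for the output, pulled back by the unital adjoint
of the channel, is a competitor for the input whose cost is no larger by the Schwarz inequality;
hence the functional increases (`parallelSum_le_of_kraus`). The integral representation of `x^s`, `0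
< s < 1`, builds the power sums from it: increasing for `α < 1`, decreasing for `1 < α < 2`. The
sign of `1/(1-α)` makes the entropy increase in both ranges (`alphaScalar_le`). Singular `σ` and `α
= 0, 1` follow by limits of the inequality; `α = 2` by continuity of the power sums.

Strong subadditivity is the case `α = 1` with the partial trace as channel, once the entropies
relative to a marginal are seen to be differences of von Neumann entropies
(`condVonNeumann_traceFst`). -/

noncomputable section

namespace QuantumEntropy


/-! ### Traces in two eigenbases and the variational formula for the parallel sum. -/

section Spectral

variable {n : Type*} [Fintype n] [DecidableEq n] {ρ M : Matrix n n ℂ}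

/-- The inner products of the eigenvectors of two Hermitian matrices. -/
def eigenOverlap (hρ : ρ.IsHermitian) (hM : M.IsHermitian) : Matrix n n ℂ :=
  star (hM.eigenvectorUnitary : Matrix n n ℂ) * (hρ.eigenvectorUnitary : Matrix n n ℂ)

/-- The transition probabilities between the eigenbases of two Hermitian matrices. -/
def eigenWeight (hρ : ρ.IsHermitian) (hM : M.IsHermitian) (x : n × n) : ℝ :=
  Complex.normSq (eigenOverlap hρ hM x.2 x.1)

lemma eigenWeight_nonneg (hρ : ρ.IsHermitian) (hM : M.IsHermitian) (x : n × n) :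
    0 ≤ eigenWeight hρ hM x := Complex.normSq_nonneg _

lemma star_eigenvectorUnitary_mul_self (hM : M.IsHermitian) :
    star (hM.eigenvectorUnitary : Matrix n n ℂ) * (hM.eigenvectorUnitary : Matrix n n ℂ) = 1 :=
  Unitary.coe_star_mul_self _

lemma eigenvectorUnitary_mul_star_self (hM : M.IsHermitian) :
    (hM.eigenvectorUnitary : Matrix n n ℂ) * star (hM.eigenvectorUnitary : Matrix n n ℂ) = 1 :=
  Unitary.coe_mul_star_self _

lemma cfc_eq_conj_diagonal (hM : M.IsHermitian) (f : ℝ → ℝ) :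
    cfc f M = (hM.eigenvectorUnitary : Matrix n n ℂ) *
      Matrix.diagonal (fun i => (f (hM.eigenvalues i) : ℂ)) *
        star (hM.eigenvectorUnitary : Matrix n n ℂ) := by
  rw [hM.cfc_eq, Matrix.IsHermitian.cfc, Unitary.conjStarAlgAut_apply]
  rfl

lemma eq_conj_diagonal (hM : M.IsHermitian) :
    M = (hM.eigenvectorUnitary : Matrix n n ℂ) *
      Matrix.diagonal (fun i => (hM.eigenvalues i : ℂ)) *
        star (hM.eigenvectorUnitary : Matrix n n ℂ) := by
  conv_lhs => rw [hM.spectral_theorem, Unitary.conjStarAlgAut_apply]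
  rfl

lemma trace_diagonal_mul_mul_conjTranspose (d : n → ℝ) (Z : Matrix n n ℂ) :
    ((Matrix.diagonal (fun i => (d i : ℂ)) * (Z * star Z)).trace).re =
      ∑ j, d j * ∑ i, Complex.normSq (Z j i) := by
  simp only [Matrix.trace, Matrix.diag_apply, Matrix.diagonal_mul, Complex.re_sum,
    Complex.re_ofReal_mul]
  refine Finset.sum_congr rfl fun j _ => ?_
  simp [Matrix.mul_apply, Matrix.star_apply, Complex.mul_conj]

/-- Cycling one unitary around the trace leaves two diagonal matrices separated by the overlap
matrix and its adjoint. The weights do not depend on `f` and `g`. -/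
lemma trace_cfc_mul_cfc (hρ : ρ.IsHermitian) (hM : M.IsHermitian) (f g : ℝ → ℝ) :
    ((cfc f ρ * cfc g M).trace).re =
      ∑ x, eigenWeight hρ hM x * f (hρ.eigenvalues x.1) * g (hM.eigenvalues x.2) := by
  rw [cfc_eq_conj_diagonal hρ, cfc_eq_conj_diagonal hM]
  set U := (hρ.eigenvectorUnitary : Matrix n n ℂ)
  set V := (hM.eigenvectorUnitary : Matrix n n ℂ)
  set D := Matrix.diagonal (fun i => (f (hρ.eigenvalues i) : ℂ))
  set G := Matrix.diagonal (fun i => (g (hM.eigenvalues i) : ℂ))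
  have h : (U * D * star U * (V * G * star V)).trace
      = (D * (star (eigenOverlap hρ hM) * (G * eigenOverlap hρ hM))).trace := by
    rw [show U * D * star U * (V * G * star V) = U * (D * (star U * V * (G * star V))) by
      simp only [mul_assoc], Matrix.trace_mul_comm]
    simp [eigenOverlap, U, V, mul_assoc]
  rw [h]
  simp only [D, G, Matrix.trace, Matrix.diag_apply, Matrix.diagonal_mul, Complex.re_sum,
    Complex.re_ofReal_mul, Fintype.sum_prod_type]
  refine Finset.sum_congr rfl fun i _ => ?_
  rw [Matrix.mul_apply, Complex.re_sum, Finset.mul_sum]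
  refine Finset.sum_congr rfl fun j _ => ?_
  simp only [Matrix.diagonal_mul, Matrix.star_apply, eigenWeight, Complex.normSq_apply,
    Complex.star_def, Complex.mul_re, Complex.mul_im, Complex.conj_re, Complex.conj_im,
    Complex.ofReal_re, Complex.ofReal_im]
  ring

/-- The quadratic form whose minimum over `Y` is the parallel sum of `ρ` and `M`. -/
def parallelCost (l : ℝ) (ρ M Y : Matrix n n ℂ) : ℝ :=
  ((M * (Y * star Y)).trace).re + l * ((ρ * (star (1 - Y) * (1 - Y))).trace).re

/-- The minimum of `parallelCost`, in terms of the spectral data of `ρ` and `M`. -/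
def parallelSum (l : ℝ) (hρ : ρ.IsHermitian) (hM : M.IsHermitian) : ℝ :=
  ∑ x, eigenWeight hρ hM x * (l * hρ.eigenvalues x.1 * hM.eigenvalues x.2 /
    (hM.eigenvalues x.2 + l * hρ.eigenvalues x.1))

/-- `M` weights the rows of `Y` and `ρ` the columns of `1 - Y`. With the eigenbasis of `M` on the
left and that of `ρ` on the right, the cost therefore splits into independent quadratics, one per
entry of `Z`, and the identity becomes the overlap matrix. -/
lemma parallelCost_eigenbasis (l : ℝ) (hρ : ρ.IsHermitian) (hM : M.IsHermitian)
    (Z : Matrix n n ℂ) :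
    parallelCost l ρ M ((hM.eigenvectorUnitary : Matrix n n ℂ) * Z *
        star (hρ.eigenvectorUnitary : Matrix n n ℂ)) =
      ∑ x : n × n, (hM.eigenvalues x.2 * Complex.normSq (Z x.2 x.1) +
        l * hρ.eigenvalues x.1 *
          Complex.normSq (eigenOverlap hρ hM x.2 x.1 - Z x.2 x.1)) := by
  have hU := star_eigenvectorUnitary_mul_self hρ
  have hU' := eigenvectorUnitary_mul_star_self hρ
  have hV := star_eigenvectorUnitary_mul_self hM
  have hV' := eigenvectorUnitary_mul_star_self hM
  have eρ := eq_conj_diagonal hρ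
  have eM := eq_conj_diagonal hM
  set U := (hρ.eigenvectorUnitary : Matrix n n ℂ) with hUdef
  set V := (hM.eigenvectorUnitary : Matrix n n ℂ) with hVdef
  set D := Matrix.diagonal (fun i => (hρ.eigenvalues i : ℂ))
  set G := Matrix.diagonal (fun i => (hM.eigenvalues i : ℂ))
  have hT : eigenOverlap hρ hM = star V * U := rfl
  have h1 : 1 - V * Z * star U = V * (eigenOverlap hρ hM - Z) * star U := by
    rw [mul_sub, sub_mul, hT, ← mul_assoc, hV', one_mul, hU']
  have t1 : (M * (V * Z * star U * star (V * Z * star U))).trace = (G * (Z * star Z)).trace := by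
    have : M * (V * Z * star U * star (V * Z * star U)) = V * (G * (Z * star Z) * star V) := by
      calc _ = V * G * (star V * V) * Z * (star U * U) * star Z * star V := by
            rw [eM]; simp only [star_mul, star_star, mul_assoc]
        _ = _ := by rw [hV, hU]; simp only [mul_one, mul_assoc]
    rw [this, Matrix.trace_mul_comm, mul_assoc, hV, mul_one]
  have t2 (W : Matrix n n ℂ) : (ρ * (star (V * W * star U) * (V * W * star U))).trace =
      (D * (star W * star (star W))).trace := by
    have : ρ * (star (V * W * star U) * (V * W * star U)) = U * (D * (star W * W) * star U) := by
      calc _ = U * D * (star U * U) * star W * (star V * V) * W * star U := by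
            rw [eρ]; simp only [star_mul, star_star, mul_assoc]
        _ = _ := by rw [hV, hU]; simp only [mul_one, mul_assoc]
    rw [this, Matrix.trace_mul_comm, mul_assoc, hU, mul_one, star_star]
  rw [parallelCost, h1, t1, t2, trace_diagonal_mul_mul_conjTranspose,
    trace_diagonal_mul_mul_conjTranspose, Finset.sum_add_distrib, Fintype.sum_prod_type_right,
    Fintype.sum_prod_type, Finset.mul_sum]
  congr 1
  · simp only [Finset.mul_sum]
  · simp only [Finset.mul_sum, Matrix.star_apply, Complex.star_def, Complex.normSq_conj,
      Matrix.sub_apply, mul_assoc]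

/-- Completing the square: the defect is `|(q + p) z - p t|² / (q + p)`, so the minimiser is `z = p
t / (q + p)`. -/
lemma normSq_le_weighted {p q : ℝ} (hp : 0 ≤ p) (hq : 0 < q) (t z : ℂ) :
    Complex.normSq t * (p * q / (q + p)) ≤
      q * Complex.normSq z + p * Complex.normSq (t - z) := by
  have h : q * Complex.normSq z + p * Complex.normSq (t - z) -
      Complex.normSq t * (p * q / (q + p)) =
        Complex.normSq ((q + p : ℝ) * z - p * t) / (q + p) := by
    have : q + p ≠ 0 := by positivity
    simp only [Complex.normSq_apply, Complex.sub_re, Complex.sub_im, Complex.mul_re,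
      Complex.mul_im, Complex.ofReal_re, Complex.ofReal_im]
    field_simp
    ring
  have h2 : 0 ≤ Complex.normSq ((q + p : ℝ) * z - p * t) / (q + p) :=
    div_nonneg (Complex.normSq_nonneg _) (by positivity)
  linarith

lemma normSq_eq_weighted {p q : ℝ} (hp : 0 ≤ p) (hq : 0 < q) (t : ℂ) :
    q * Complex.normSq ((p / (q + p) : ℝ) * t) +
      p * Complex.normSq (t - (p / (q + p) : ℝ) * t) =
        Complex.normSq t * (p * q / (q + p)) := by
  have : q + p ≠ 0 := by positivity
  simp only [Complex.normSq_apply, Complex.sub_re, Complex.sub_im, Complex.mul_re,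
    Complex.mul_im, Complex.ofReal_re, Complex.ofReal_im]
  field_simp
  ring

lemma parallelSum_le_parallelCost {l : ℝ} (hl : 0 < l) (hρ : ρ.PosSemidef) (hM : M.PosDef)
    (Y : Matrix n n ℂ) :
    parallelSum l hρ.isHermitian hM.isHermitian ≤ parallelCost l ρ M Y := by
  have hY : Y = (hM.isHermitian.eigenvectorUnitary : Matrix n n ℂ) *
      (star (hM.isHermitian.eigenvectorUnitary : Matrix n n ℂ) * Y *
        (hρ.isHermitian.eigenvectorUnitary : Matrix n n ℂ)) *
        star (hρ.isHermitian.eigenvectorUnitary : Matrix n n ℂ) := by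
    calc Y = (hM.isHermitian.eigenvectorUnitary : Matrix n n ℂ) *
          star (hM.isHermitian.eigenvectorUnitary : Matrix n n ℂ) * Y *
          ((hρ.isHermitian.eigenvectorUnitary : Matrix n n ℂ) *
            star (hρ.isHermitian.eigenvectorUnitary : Matrix n n ℂ)) := by
          rw [eigenvectorUnitary_mul_star_self, eigenvectorUnitary_mul_star_self, one_mul, mul_one]
      _ = _ := by simp only [mul_assoc]
  rw [hY, parallelCost_eigenbasis]
  refine Finset.sum_le_sum fun x _ => ?_
  exact normSq_le_weighted (mul_nonneg hl.le (hρ.eigenvalues_nonneg _)) (hM.eigenvalues_pos _) _ _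

lemma exists_parallelCost_eq {l : ℝ} (hl : 0 < l) (hρ : ρ.PosSemidef) (hM : M.PosDef) :
    ∃ Y, parallelCost l ρ M Y = parallelSum l hρ.isHermitian hM.isHermitian := by
  refine ⟨_, (parallelCost_eigenbasis l hρ.isHermitian hM.isHermitian
    (Matrix.of fun j i => ((l * hρ.isHermitian.eigenvalues i / (hM.isHermitian.eigenvalues j +
      l * hρ.isHermitian.eigenvalues i) : ℝ) : ℂ) *
        eigenOverlap hρ.isHermitian hM.isHermitian j i)).trans ?_⟩
  refine Finset.sum_congr rfl fun x _ => ?_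
  exact normSq_eq_weighted (mul_nonneg hl.le (hρ.eigenvalues_nonneg _)) (hM.eigenvalues_pos _) _

end Spectral


/-! ### Power sums as integrals of parallel sums. -/

section Scalar

variable {N N' : Type*} [Fintype N] [Fintype N']

/-- The classical quasi-entropy `∑ w p^α q^(1-α)`. -/
def powerSum (w p q : N → ℝ) (α : ℝ) : ℝ := ∑ x, w x * p x ^ α * q x ^ (1 - α)

open MeasureTheory Set in
lemma integral_sum_mul_rpowIntegrand {s : ℝ} (hs : s ∈ Ioo (0 : ℝ) 1) (b y : N → ℝ)
    (hy : ∀ i, 0 ≤ y i) :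
    IntegrableOn (fun t => ∑ i, b i * Real.rpowIntegrand₀₁ s t (y i)) (Ioi 0) ∧
    ∫ t in Ioi 0, ∑ i, b i * Real.rpowIntegrand₀₁ s t (y i) =
      (∑ i, b i * y i ^ s) * ∫ t in Ioi 0, Real.rpowIntegrand₀₁ s t 1 := by
  have hi : ∀ i ∈ Finset.univ, Integrable (fun t => b i * Real.rpowIntegrand₀₁ s t (y i))
      (volume.restrict (Ioi 0)) := fun i _ =>
    (Real.integrableOn_rpowIntegrand₀₁_Ioi hs (hy i)).const_mul (b i)
  refine ⟨integrable_finsetSum _ hi, ?_⟩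
  rw [integral_finsetSum _ hi, Finset.sum_mul]
  refine Finset.sum_congr rfl fun i _ => ?_
  rw [integral_const_mul, Real.integral_rpowIntegrand₀₁_eq_rpow_mul_const hs (hy i), mul_assoc]

-- Both sides carry the same positive constant `∫ rpowIntegrand₀₁ s t 1`, so it cancels after
-- integrating over `t`. The coefficients may have any sign.
open MeasureTheory Set in
lemma sum_mul_rpow_le_of_integrand_le {s : ℝ} (hs : s ∈ Ioo (0 : ℝ) 1) {a x : N → ℝ}
    {a' x' : N' → ℝ} (hx : ∀ i, 0 ≤ x i) (hx' : ∀ i, 0 ≤ x' i)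
    (h : ∀ t : ℝ, 0 < t → ∑ i, a i * Real.rpowIntegrand₀₁ s t (x i) ≤
      ∑ i, a' i * Real.rpowIntegrand₀₁ s t (x' i)) :
    ∑ i, a i * x i ^ s ≤ ∑ i, a' i * x' i ^ s := by
  obtain ⟨i1, e1⟩ := integral_sum_mul_rpowIntegrand hs a x hx
  obtain ⟨i2, e2⟩ := integral_sum_mul_rpowIntegrand hs a' x' hx'
  have hle := setIntegral_mono_on i1 i2 measurableSet_Ioi h
  rw [e1, e2] at hle
  exact le_of_mul_le_mul_right hle (Real.integral_rpowIntegrand₀₁_one_pos hs)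

/-- Where `p x = 0`, the quotient is the junk value `0`, but both sides vanish: on the left because
`0 ^ α = 0` for `α > 0`, on the right through the factor `p x`. -/
lemma powerSum_eq_of_lt_one {w p q : N → ℝ} (hp : ∀ x, 0 ≤ p x) (hq : ∀ x, 0 < q x)
    {α : ℝ} (h0 : 0 < α) :
    powerSum w p q α = ∑ x, (w x * p x) * (q x / p x) ^ (1 - α) := by
  refine Finset.sum_congr rfl fun x _ => ?_
  rcases (hp x).eq_or_lt with h | h
  · simp [← h, Real.zero_rpow h0.ne']
  · rw [Real.div_rpow (hq x).le h.le, Real.rpow_sub h, Real.rpow_one]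
    have := (Real.rpow_pos_of_pos h α).ne'
    field_simp

lemma powerSum_eq_of_one_lt {w p q : N → ℝ} (hp : ∀ x, 0 ≤ p x) (hq : ∀ x, 0 < q x)
    {α : ℝ} (h0 : 0 < α) :
    powerSum w p q α = ∑ x, (w x * p x) * (p x / q x) ^ (α - 1) := by
  refine Finset.sum_congr rfl fun x _ => ?_
  rcases (hp x).eq_or_lt with h | h
  · simp [← h, Real.zero_rpow h0.ne']
  · rw [Real.div_rpow h.le (hq x).le, Real.rpow_sub h, Real.rpow_one,
      show (1 - α) = -(α - 1) by ring, Real.rpow_neg (hq x).le]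
    have := (Real.rpow_pos_of_pos (hq x) (α - 1)).ne'
    field_simp

variable {w p q : N → ℝ} {w' p' q' : N' → ℝ}

lemma sum_rpowIntegrand_one_sub {α : ℝ} (hs : 1 - α ∈ Set.Ioo (0 : ℝ) 1) {t : ℝ} (ht : 0 < t)
    {w p q : N → ℝ} (hp : ∀ x, 0 ≤ p x) (hq : ∀ x, 0 < q x) :
    ∑ x, w x * p x * Real.rpowIntegrand₀₁ (1 - α) t (q x / p x) =
      t ^ (1 - α - 1) / t * ∑ x, w x * (t * p x * q x / (q x + t * p x)) := by
  rw [Finset.mul_sum]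
  refine Finset.sum_congr rfl fun x _ => ?_
  rw [Real.rpowIntegrand₀₁_eq_pow_div hs ht.le (div_nonneg (hq x).le (hp x))]
  rcases (hp x).eq_or_lt with h | h
  · simp [← h]
  · have := hq x
    have : t + q x / p x ≠ 0 := by positivity
    have : q x + t * p x ≠ 0 := by positivity
    field_simp
    ring

lemma powerSum_le_of_lt_one (hp : ∀ x, 0 ≤ p x) (hq : ∀ x, 0 < q x) (hp' : ∀ x, 0 ≤ p' x)
    (hq' : ∀ x, 0 < q' x)
    (h : ∀ l : ℝ, 0 < l → ∑ x, w x * (l * p x * q x / (q x + l * p x)) ≤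
      ∑ x, w' x * (l * p' x * q' x / (q' x + l * p' x)))
    {α : ℝ} (h0 : 0 < α) (h1 : α < 1) : powerSum w p q α ≤ powerSum w' p' q' α := by
  have hs : 1 - α ∈ Set.Ioo (0 : ℝ) 1 := ⟨by linarith, by linarith⟩
  rw [powerSum_eq_of_lt_one hp hq h0, powerSum_eq_of_lt_one hp' hq' h0]
  have hx : ∀ x, 0 ≤ q x / p x := fun x => div_nonneg (hq x).le (hp x)
  have hx' : ∀ x, 0 ≤ q' x / p' x := fun x => div_nonneg (hq' x).le (hp' x)
  refine sum_mul_rpow_le_of_integrand_le hs hx hx' fun t ht => ?_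
  rw [sum_rpowIntegrand_one_sub hs ht hp hq, sum_rpowIntegrand_one_sub hs ht hp' hq']
  exact mul_le_mul_of_nonneg_left (h t ht) (by positivity)

/-- Since `p² / (t q + p) = p - t p q / (t q + p)`, the parallel sum enters with a minus sign and
parameter `l = t⁻¹`. This reverses the monotonicity for `α > 1` and is why `∑ w p` must be
preserved. -/
lemma sum_rpowIntegrand_sub_one {α : ℝ} (hs : α - 1 ∈ Set.Ioo (0 : ℝ) 1) {t : ℝ} (ht : 0 < t)
    {w p q : N → ℝ} (hp : ∀ x, 0 ≤ p x) (hq : ∀ x, 0 < q x) :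
    ∑ x, w x * p x * Real.rpowIntegrand₀₁ (α - 1) t (p x / q x) =
      t ^ (α - 1 - 1) * (∑ x, w x * p x -
        t * ∑ x, w x * (t⁻¹ * p x * q x / (q x + t⁻¹ * p x))) := by
  rw [Finset.mul_sum, ← Finset.sum_sub_distrib, Finset.mul_sum]
  refine Finset.sum_congr rfl fun x _ => ?_
  rw [Real.rpowIntegrand₀₁_eq_pow_div hs ht.le (div_nonneg (hp x) (hq x).le)]
  have := hq x
  have := hp x
  have : t * q x + p x ≠ 0 := by positivity
  have e1 : t + p x / q x = (t * q x + p x) / q x := by field_simp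
  have e2 : q x + t⁻¹ * p x = (t * q x + p x) / t := by field_simp
  rw [e1, e2]
  field_simp
  ring

lemma powerSum_le_of_one_lt (hp : ∀ x, 0 ≤ p x) (hq : ∀ x, 0 < q x) (hp' : ∀ x, 0 ≤ p' x)
    (hq' : ∀ x, 0 < q' x) (hsum : ∑ x, w x * p x = ∑ x, w' x * p' x)
    (h : ∀ l : ℝ, 0 < l → ∑ x, w x * (l * p x * q x / (q x + l * p x)) ≤
      ∑ x, w' x * (l * p' x * q' x / (q' x + l * p' x)))
    {α : ℝ} (h1 : 1 < α) (h2 : α < 2) : powerSum w' p' q' α ≤ powerSum w p q α := by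
  have hs : α - 1 ∈ Set.Ioo (0 : ℝ) 1 := ⟨by linarith, by linarith⟩
  rw [powerSum_eq_of_one_lt hp hq (by linarith), powerSum_eq_of_one_lt hp' hq' (by linarith)]
  have hx : ∀ x, 0 ≤ p x / q x := fun x => div_nonneg (hp x) (hq x).le
  have hx' : ∀ x, 0 ≤ p' x / q' x := fun x => div_nonneg (hp' x) (hq' x).le
  refine sum_mul_rpow_le_of_integrand_le hs hx' hx fun t ht => ?_
  rw [sum_rpowIntegrand_sub_one hs ht hp hq, sum_rpowIntegrand_sub_one hs ht hp' hq', hsum]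
  refine mul_le_mul_of_nonneg_left ?_ (by positivity)
  have := mul_le_mul_of_nonneg_left (h t⁻¹ (inv_pos.mpr ht)) ht.le
  linarith

end Scalar


/-! ### Limits of the classical expressions in `ξ` and in `α`. -/

section ScalarLimits

variable {N : Type*} [Fintype N]

/-- Non-negative spectral data `p`, `q` with weights `w` for which `∑ w p = 1`. -/
structure IsSpectralPair (w p q : N → ℝ) : Prop where
  w_nonneg : ∀ x, 0 ≤ w x
  p_nonneg : ∀ x, 0 ≤ p x
  q_nonneg : ∀ x, 0 ≤ q x
  sum_eq_one : ∑ x, w x * p x = 1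

/-- The classical expression `1/(1-α) log ∑ w p^α q^(1-α)`. -/
def alphaScalar (w p q : N → ℝ) (α : ℝ) : ℝ := 1 / (1 - α) * Real.logb 2 (powerSum w p q α)

open Classical in
/-- The limit of `alphaScalar w p (q + ξ) α` for `ξ ↓ 0`. -/
def alphaLimit (w p q : N → ℝ) (α : ℝ) : EReal :=
  if (α < 1 ∧ ∀ x, w x * p x * q x = 0) ∨ (1 < α ∧ ∃ x, w x * p x ≠ 0 ∧ q x = 0) then ⊥
  else (alphaScalar w p q α : EReal)

/-- The classical expression `∑ w p (log q - log p)`. -/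
def logScalar (w p q : N → ℝ) : ℝ := ∑ x, w x * p x * (Real.logb 2 (q x) - Real.logb 2 (p x))

open Classical in
/-- The limit of `logScalar w p (q + ξ)` for `ξ ↓ 0`. -/
def logLimit (w p q : N → ℝ) : EReal :=
  if ∃ x, w x * p x ≠ 0 ∧ q x = 0 then ⊥ else (logScalar w p q : EReal)

namespace IsSpectralPair

variable {w p q : N → ℝ}

lemma exists_ne_zero (h : IsSpectralPair w p q) : ∃ x, w x * p x ≠ 0 := by
  by_contra! hc
  have := h.sum_eq_one
  simp [hc] at this

lemma add_const (h : IsSpectralPair w p q) {ξ : ℝ} (hξ : 0 ≤ ξ) :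
    IsSpectralPair w p (fun x => q x + ξ) :=
  ⟨h.w_nonneg, h.p_nonneg, fun x => add_nonneg (h.q_nonneg x) hξ, h.sum_eq_one⟩

lemma term_nonneg (h : IsSpectralPair w p q) (α : ℝ) (x : N) :
    0 ≤ w x * p x ^ α * q x ^ (1 - α) :=
  mul_nonneg (mul_nonneg (h.w_nonneg x) (Real.rpow_nonneg (h.p_nonneg x) _))
    (Real.rpow_nonneg (h.q_nonneg x) _)

lemma pos_of_mul_ne_zero (h : IsSpectralPair w p q) {x : N} (hx : w x * p x ≠ 0) :
    0 < w x ∧ 0 < p x :=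
  ⟨(h.w_nonneg x).lt_of_ne' (left_ne_zero_of_mul hx),
    (h.p_nonneg x).lt_of_ne' (right_ne_zero_of_mul hx)⟩

lemma powerSum_pos (h : IsSpectralPair w p q) (α : ℝ) {x : N} (hx : w x * p x * q x ≠ 0) :
    0 < powerSum w p q α := by
  obtain ⟨hw, hp⟩ := h.pos_of_mul_ne_zero (left_ne_zero_of_mul hx)
  have hq := (h.q_nonneg x).lt_of_ne' (right_ne_zero_of_mul hx)
  refine Finset.sum_pos' (fun y _ => h.term_nonneg α y) ⟨x, Finset.mem_univ x, ?_⟩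
  exact mul_pos (mul_pos hw (Real.rpow_pos_of_pos hp _)) (Real.rpow_pos_of_pos hq _)

lemma powerSum_pos_of_pos (h : IsSpectralPair w p q) (hq : ∀ x, 0 < q x) (α : ℝ) :
    0 < powerSum w p q α := by
  obtain ⟨x, hx⟩ := h.exists_ne_zero
  exact h.powerSum_pos α (mul_ne_zero hx (hq x).ne')

lemma powerSum_eq_zero {α : ℝ} (h0 : 0 < α) (h1 : α < 1) (hz : ∀ x, w x * p x * q x = 0) :
    powerSum w p q α = 0 := by
  refine Finset.sum_eq_zero fun x _ => ?_
  rcases mul_eq_zero.mp (hz x) with hx | hx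
  · rcases mul_eq_zero.mp hx with hx | hx
    · simp [hx]
    · simp [hx, Real.zero_rpow h0.ne']
  · simp [hx, Real.zero_rpow (sub_pos.mpr h1).ne']

lemma tendsto_add_const (a : ℝ) : Tendsto (fun ξ : ℝ => a + ξ) (𝓝[>] 0) (𝓝 a) := by
  have : Tendsto (fun ξ : ℝ => a + ξ) (𝓝 0) (𝓝 (a + 0)) :=
    (continuous_const.add continuous_id).tendsto 0
  rw [add_zero] at this
  exact this.mono_left nhdsWithin_le_nhds

lemma tendsto_one_sub (a : ℝ) : Tendsto (fun α : ℝ => 1 - α) (𝓝 a) (𝓝 (1 - a)) :=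
  (continuous_const.sub continuous_id).tendsto a

/-- For `α < 1` the exponent `1 - α` is positive and the power is continuous even at `q x = 0`; for
other `α` continuity needs `q x ≠ 0` wherever the term survives. -/
lemma tendsto_powerSum_add {α : ℝ} (h0 : 0 < α)
    (hs : α < 1 ∨ ∀ x, w x * p x ≠ 0 → q x ≠ 0) :
    Tendsto (fun ξ : ℝ => powerSum w p (fun x => q x + ξ) α) (𝓝[>] 0)
      (𝓝 (powerSum w p q α)) := by
  refine tendsto_finsetSum _ fun x _ => ?_
  by_cases hx : w x * p x = 0
  · have : w x * p x ^ α = 0 := by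
      rcases mul_eq_zero.mp hx with hx | hx
      · simp [hx]
      · simp [hx, Real.zero_rpow h0.ne']
    simp [this]
  · refine Tendsto.const_mul _ ?_
    refine (Real.continuousAt_rpow_const _ _ ?_).tendsto.comp (tendsto_add_const (q x))
    exact hs.elim (fun h1 => Or.inr (by linarith)) (fun h1 => Or.inl (h1 x hx))

lemma tendsto_alphaScalar_add (h : IsSpectralPair w p q) {α : ℝ} (h0 : 0 < α) (h1 : α ≠ 1) :
    Tendsto (fun ξ : ℝ => (alphaScalar w p (fun x => q x + ξ) α : EReal)) (𝓝[>] 0)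
      (𝓝 (alphaLimit w p q α)) := by
  have hpos : ∀ᶠ ξ : ℝ in 𝓝[>] 0, 0 < powerSum w p (fun x => q x + ξ) α := by
    filter_upwards [self_mem_nhdsWithin] with ξ hξ
    exact (h.add_const (le_of_lt hξ)).powerSum_pos_of_pos
      (fun x => add_pos_of_nonneg_of_pos (h.q_nonneg x) hξ) α
  unfold alphaLimit
  split_ifs with hc
  · rw [EReal.tendsto_coe_nhds_bot_iff]
    rcases hc with ⟨hα, hz⟩ | ⟨hα, x, hx, hqx⟩
    · have ht := tendsto_powerSum_add (w := w) (p := p) (q := q) h0 (Or.inl hα)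
      rw [powerSum_eq_zero h0 hα hz] at ht
      refine Tendsto.const_mul_atBot (by have := sub_pos.mpr hα; positivity) ?_
      exact (Real.tendsto_logb_nhdsGT_zero one_lt_two).comp
        (tendsto_nhdsWithin_iff.mpr ⟨ht, hpos⟩)
    -- The single term at `x`, a positive multiple of `ξ ^ (1 - α)`, already forces the sum to
    -- infinity.
    · refine Tendsto.const_mul_atTop_of_neg (one_div_neg.mpr (by linarith)) ?_
      refine (Real.tendsto_logb_atTop one_lt_two).comp ?_
      obtain ⟨hw, hp⟩ := h.pos_of_mul_ne_zero hx
      have hc : 0 < w x * p x ^ α := mul_pos hw (Real.rpow_pos_of_pos hp _)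
      refine tendsto_atTop_mono' _ ?_
        ((tendsto_rpow_neg_nhdsGT_zero (y := 1 - α) (by linarith)).const_mul_atTop hc)
      filter_upwards [self_mem_nhdsWithin] with ξ hξ
      have := Finset.single_le_sum (fun y _ => (h.add_const (le_of_lt hξ)).term_nonneg α y)
        (Finset.mem_univ x)
      simpa [hqx, powerSum] using this
  · rw [not_or] at hc
    rw [EReal.tendsto_coe]
    refine Tendsto.const_mul _ ?_
    rcases lt_or_gt_of_ne h1 with hα | hα
    · have hz : ∃ x, w x * p x * q x ≠ 0 := by
        by_contra! hz
        exact hc.1 ⟨hα, hz⟩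
      obtain ⟨x, hx⟩ := hz
      exact (tendsto_powerSum_add h0 (Or.inl hα)).logb (h.powerSum_pos α hx).ne'
    · have hs : ∀ x, w x * p x ≠ 0 → q x ≠ 0 := fun x hx hq => hc.2 ⟨hα, x, hx, hq⟩
      obtain ⟨x, hx⟩ := h.exists_ne_zero
      exact (tendsto_powerSum_add h0 (Or.inr hs)).logb
        (h.powerSum_pos α (mul_ne_zero hx (hs x hx))).ne'

lemma exists_tendsto_alphaLimit_zero (h : IsSpectralPair w p q) :
    ∃ L, Tendsto (alphaLimit w p q) (𝓝[>] 0) (𝓝 L) := by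
  have hlt : ∀ᶠ α : ℝ in 𝓝[>] 0, α < 1 := nhdsWithin_le_nhds (eventually_lt_nhds one_pos)
  by_cases hz : ∀ x, w x * p x * q x = 0
  · refine ⟨⊥, tendsto_const_nhds.congr' ?_⟩
    filter_upwards [hlt] with α hα
    rw [alphaLimit, if_pos (Or.inl ⟨hα, hz⟩)]
  -- As `α ↓ 0`, `p ^ α` tends to the indicator of `p ≠ 0`. This differs from its value at `α = 0`,
  -- where `0 ^ 0 = 1`.
  · set S : ℝ := ∑ x, w x * (if p x = 0 then 0 else 1) * q x with hS
    have hS0 : 0 < S := by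
      push Not at hz
      obtain ⟨x, hx⟩ := hz
      refine Finset.sum_pos' (fun y _ => ?_) ⟨x, Finset.mem_univ x, ?_⟩
      · refine mul_nonneg (mul_nonneg (h.w_nonneg y) ?_) (h.q_nonneg y)
        split_ifs <;> norm_num
      · obtain ⟨hw, hp⟩ := h.pos_of_mul_ne_zero (left_ne_zero_of_mul hx)
        have hq := (h.q_nonneg x).lt_of_ne' (right_ne_zero_of_mul hx)
        rw [if_neg hp.ne']
        positivity
    have ht : Tendsto (powerSum w p q) (𝓝[>] 0) (𝓝 S) := by
      refine tendsto_finsetSum _ fun x _ => Tendsto.mul (Tendsto.const_mul _ ?_) ?_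
      · split_ifs with hp
        · refine tendsto_const_nhds.congr' ?_
          filter_upwards [self_mem_nhdsWithin] with α hα
          rw [hp, Real.zero_rpow (ne_of_gt hα)]
        · have := (Real.continuousAt_const_rpow (b := 0) hp).tendsto
          rw [Real.rpow_zero] at this
          exact this.mono_left nhdsWithin_le_nhds
      · have h1 : Tendsto (fun y : ℝ => q x ^ y) (𝓝 1) (𝓝 (q x ^ (1 : ℝ))) :=
          (Real.continuousAt_const_rpow' one_ne_zero).tendsto
        rw [Real.rpow_one] at h1
        have h2 := tendsto_one_sub 0
        rw [sub_zero] at h2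
        exact (h1.comp h2).mono_left nhdsWithin_le_nhds
    have h2 : Tendsto (fun α : ℝ => 1 / (1 - α)) (𝓝[>] 0) (𝓝 (1 / (1 - 0))) := by
      have : ContinuousAt (fun α : ℝ => 1 / (1 - α)) 0 := by
        refine continuousAt_const.div (by fun_prop) (by norm_num)
      exact this.tendsto.mono_left nhdsWithin_le_nhds
    refine ⟨_, Tendsto.congr' ?_ (EReal.tendsto_coe.mpr (h2.mul (ht.logb (b := 2) hS0.ne')))⟩
    filter_upwards [hlt] with α hα
    rw [alphaLimit, if_neg]
    · rfl
    · rintro (⟨-, h'⟩ | ⟨h', -⟩)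
      · exact hz h'
      · exact absurd h' (not_lt.mpr hα.le)

lemma hasDerivAt_powerSum_one (h : IsSpectralPair w p q) (hs : ∀ x, w x * p x ≠ 0 → q x ≠ 0) :
    HasDerivAt (powerSum w p q) (∑ x, w x * p x * (Real.log (p x) - Real.log (q x))) 1 := by
  refine HasDerivAt.fun_sum fun x _ => ?_
  by_cases hx : w x * p x = 0
  · rw [hx, zero_mul]
    refine (hasDerivAt_const (1 : ℝ) (0 : ℝ)).congr_of_eventuallyEq ?_
    filter_upwards [eventually_gt_nhds one_pos] with α hα
    rcases mul_eq_zero.mp hx with hx | hx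
    · simp [hx]
    · simp [hx, Real.zero_rpow hα.ne']
  · have hp := (h.pos_of_mul_ne_zero hx).2
    have hq := (h.q_nonneg x).lt_of_ne' (hs x hx)
    have d1 := ((hasDerivAt_id (1 : ℝ)).const_rpow hp).const_mul (w x)
    have d2 := ((hasDerivAt_id (1 : ℝ)).const_sub 1).const_rpow hq
    refine (d1.mul d2).congr_deriv ?_
    simp only [id, Real.rpow_one, sub_self, Real.rpow_zero]
    ring

lemma powerSum_one (h : IsSpectralPair w p q) : powerSum w p q 1 = 1 := by
  simpa [powerSum] using h.sum_eq_one

/-- Because the power sum equals `1` at `α = 1`, `alphaScalar` is the slope of its logarithm at `1`,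
divided by `-log 2`. -/
lemma tendsto_alphaScalar_one (h : IsSpectralPair w p q) (hs : ∀ x, w x * p x ≠ 0 → q x ≠ 0) :
    Tendsto (alphaScalar w p q) (𝓝[≠] 1) (𝓝 (logScalar w p q)) := by
  have hd := (h.hasDerivAt_powerSum_one hs).log (by rw [h.powerSum_one]; exact one_ne_zero)
  have ht := (hasDerivAt_iff_tendsto_slope.mp hd).div_const (-Real.log 2)
  have e1 : (∑ x, w x * p x * (Real.log (p x) - Real.log (q x))) / powerSum w p q 1 /
      -Real.log 2 = logScalar w p q := by
    rw [h.powerSum_one, div_one, Finset.sum_div, logScalar]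
    refine Finset.sum_congr rfl fun x _ => ?_
    simp only [Real.logb]
    have : Real.log 2 ≠ 0 := (Real.log_pos one_lt_two).ne'
    field_simp
    ring
  rw [e1] at ht
  refine ht.congr' ?_
  filter_upwards [self_mem_nhdsWithin] with α hα
  have h1 : α - 1 ≠ 0 := sub_ne_zero.mpr hα
  have h2 : 1 - α ≠ 0 := sub_ne_zero.mpr (Ne.symm hα)
  have : Real.log 2 ≠ 0 := (Real.log_pos one_lt_two).ne'
  rw [slope_def_field, h.powerSum_one, Real.log_one, sub_zero, alphaScalar, Real.logb,
    show α - 1 = -(1 - α) by ring]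
  field_simp

lemma tendsto_alphaLimit_one (h : IsSpectralPair w p q) :
    Tendsto (alphaLimit w p q) (𝓝[≠] 1) (𝓝 (logLimit w p q)) := by
  unfold logLimit
  split_ifs with hc
  · rw [← nhdsLT_sup_nhdsGT, tendsto_sup]
    constructor
    · by_cases hz : ∀ x, w x * p x * q x = 0
      · refine tendsto_const_nhds.congr' ?_
        filter_upwards [self_mem_nhdsWithin] with α hα
        rw [alphaLimit, if_pos (Or.inl ⟨hα, hz⟩)]
      · obtain ⟨x₀, hx₀, hq₀⟩ := hc
        obtain ⟨y, hy⟩ := not_forall.mp hz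
        -- `S` is the mass of `w p` on `q ≠ 0`, the left limit of the power sum. It is strictly less
        -- than `1` because `x₀` is lost, so `log S < 0` while `1/(1-α) → ∞`.
        set S : ℝ := ∑ x, w x * p x * (if q x = 0 then 0 else 1) with hS
        have hS0 : 0 < S := by
          refine Finset.sum_pos' (fun x _ => ?_) ⟨y, Finset.mem_univ y, ?_⟩
          · refine mul_nonneg (mul_nonneg (h.w_nonneg x) (h.p_nonneg x)) ?_
            split_ifs <;> norm_num
          · obtain ⟨hw, hp⟩ := h.pos_of_mul_ne_zero (left_ne_zero_of_mul hy)
            rw [if_neg (right_ne_zero_of_mul hy)]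
            positivity
        have hS1 : S < 1 := by
          rw [← h.sum_eq_one]
          refine Finset.sum_lt_sum (fun x _ => ?_) ⟨x₀, Finset.mem_univ _, ?_⟩
          · have := mul_nonneg (h.w_nonneg x) (h.p_nonneg x)
            split_ifs <;> linarith
          · obtain ⟨hw, hp⟩ := h.pos_of_mul_ne_zero hx₀
            rw [if_pos hq₀, mul_zero]
            positivity
        have ht : Tendsto (powerSum w p q) (𝓝[<] 1) (𝓝 S) := by
          refine tendsto_finsetSum _ fun x _ => Tendsto.mul (Tendsto.const_mul _ ?_) ?_
          · have := (Real.continuousAt_const_rpow' (a := p x) one_ne_zero).tendsto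
            rw [Real.rpow_one] at this
            exact this.mono_left nhdsWithin_le_nhds
          · split_ifs with hq
            · refine tendsto_const_nhds.congr' ?_
              filter_upwards [self_mem_nhdsWithin] with α hα
              rw [hq, Real.zero_rpow (sub_pos.mpr hα).ne']
            · have h1 := (Real.continuousAt_const_rpow (b := 0) hq).tendsto
              rw [Real.rpow_zero] at h1
              have h2 := tendsto_one_sub 1
              rw [sub_self] at h2
              exact (h1.comp h2).mono_left nhdsWithin_le_nhds
        have hinv : Tendsto (fun α : ℝ => 1 / (1 - α)) (𝓝[<] 1) atTop := by
          simp only [one_div]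
          refine tendsto_inv_nhdsGT_zero.comp (tendsto_nhdsWithin_iff.mpr ⟨?_, ?_⟩)
          · have h2 := tendsto_one_sub 1
            rw [sub_self] at h2
            exact h2.mono_left nhdsWithin_le_nhds
          · filter_upwards [self_mem_nhdsWithin] with α hα
            exact sub_pos.mpr (Set.mem_Iio.mp hα)
        refine (EReal.tendsto_coe_nhds_bot_iff.mpr (hinv.atTop_mul_neg
          (Real.logb_neg one_lt_two hS0 hS1) (ht.logb (b := 2) hS0.ne'))).congr' ?_
        filter_upwards [self_mem_nhdsWithin] with α hα
        rw [alphaLimit, if_neg]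
        · rfl
        · rintro (⟨-, h'⟩ | ⟨h', -⟩)
          · exact hz h'
          · exact absurd h' (not_lt.mpr (le_of_lt hα))
    · refine tendsto_const_nhds.congr' ?_
      filter_upwards [self_mem_nhdsWithin] with α hα
      rw [alphaLimit, if_pos (Or.inr ⟨hα, hc⟩)]
  · have hs : ∀ x, w x * p x ≠ 0 → q x ≠ 0 := fun x hx hq => hc ⟨x, hx, hq⟩
    refine (EReal.tendsto_coe.mpr (h.tendsto_alphaScalar_one hs)).congr fun α => ?_
    rw [alphaLimit, if_neg]
    rintro (⟨-, h'⟩ | ⟨-, h'⟩)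
    · obtain ⟨x, hx⟩ := h.exists_ne_zero
      exact mul_ne_zero hx (hs x hx) (h' x)
    · exact hc h'

lemma tendsto_logScalar_add (h : IsSpectralPair w p q) :
    Tendsto (fun ξ : ℝ => (logScalar w p (fun x => q x + ξ) : EReal)) (𝓝[>] 0)
      (𝓝 (logLimit w p q)) := by
  classical
  unfold logLimit
  split_ifs with hc
  · rw [EReal.tendsto_coe_nhds_bot_iff]
    obtain ⟨x₀, hx₀, hq₀⟩ := hc
    obtain ⟨hw, hp⟩ := h.pos_of_mul_ne_zero hx₀
    -- An upper bound for `0 < ξ < 1`: the term at `x₀` carries `log ξ`, and `log (q + ξ) ≤ |log (q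
    -- + 1)|` bounds the others uniformly.
    have hlim : Tendsto (fun ξ : ℝ => w x₀ * p x₀ * Real.logb 2 ξ +
        ∑ x, w x * p x * (|Real.logb 2 (q x + 1)| - Real.logb 2 (p x))) (𝓝[>] 0) atBot :=
      tendsto_atBot_add_const_right _ _
        ((Real.tendsto_logb_nhdsGT_zero one_lt_two).const_mul_atBot (mul_pos hw hp))
    refine tendsto_atBot_mono' _ ?_ hlim
    filter_upwards [self_mem_nhdsWithin, nhdsWithin_le_nhds (eventually_lt_nhds one_pos)]
      with ξ hξ hξ1
    have hsingle : w x₀ * p x₀ * Real.logb 2 ξ =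
        ∑ x, if x = x₀ then w x * p x * Real.logb 2 ξ else 0 := by simp
    rw [hsingle, ← Finset.sum_add_distrib]
    refine Finset.sum_le_sum fun x _ => ?_
    have hwp := mul_nonneg (h.w_nonneg x) (h.p_nonneg x)
    split_ifs with hx
    · subst hx
      rw [← mul_add]
      refine mul_le_mul_of_nonneg_left ?_ hwp
      have := abs_nonneg (Real.logb 2 (q x + 1))
      simp only [hq₀, zero_add] at this ⊢
      linarith
    · rw [zero_add]
      refine mul_le_mul_of_nonneg_left (sub_le_sub_right (le_trans ?_ (le_abs_self _)) _) hwp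
      exact Real.logb_le_logb_of_le one_lt_two (add_pos_of_nonneg_of_pos (h.q_nonneg x) hξ)
        (by linarith)
  · rw [EReal.tendsto_coe]
    refine tendsto_finsetSum _ fun x _ => ?_
    by_cases hx : w x * p x = 0
    · simp [hx]
    · have hq : q x ≠ 0 := fun hq => hc ⟨x, hx, hq⟩
      exact (((tendsto_add_const (q x)).logb hq).sub_const _).const_mul _

lemma alphaLimit_of_pos (h : IsSpectralPair w p q) (hq : ∀ x, 0 < q x) (α : ℝ) :
    alphaLimit w p q α = alphaScalar w p q α := by
  rw [alphaLimit, if_neg]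
  rintro (⟨-, h'⟩ | ⟨-, x, -, h'⟩)
  · obtain ⟨x, hx⟩ := h.exists_ne_zero
    exact mul_ne_zero hx (hq x).ne' (h' x)
  · exact (hq x).ne' h'

lemma continuousAt_powerSum (hq : ∀ x, 0 < q x) {α : ℝ} (hα : α ≠ 0) :
    ContinuousAt (powerSum w p q) α := by
  refine tendsto_finsetSum _ fun x _ => Tendsto.mul (Tendsto.const_mul _ ?_) ?_
  · exact (Real.continuousAt_const_rpow' hα).tendsto
  · have h1 := (Real.continuousAt_const_rpow (b := 1 - α) (hq x).ne').tendsto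
    have h2 := tendsto_one_sub α
    exact h1.comp h2

variable {N' : Type*} [Fintype N'] {w' p' q' : N' → ℝ}

lemma alphaScalar_le (h : IsSpectralPair w p q) (h' : IsSpectralPair w' p' q')
    (hq : ∀ x, 0 < q x) (hq' : ∀ x, 0 < q' x)
    (hF : ∀ l : ℝ, 0 < l → ∑ x, w x * (l * p x * q x / (q x + l * p x)) ≤
      ∑ x, w' x * (l * p' x * q' x / (q' x + l * p' x)))
    {α : ℝ} (h0 : 0 < α) (h1 : α ≠ 1) (h2 : α ≤ 2) :
    alphaScalar w p q α ≤ alphaScalar w' p' q' α := by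
  have hpos := h.powerSum_pos_of_pos hq α
  have hpos' := h'.powerSum_pos_of_pos hq' α
  rcases lt_or_gt_of_ne h1 with hα | hα
  · refine mul_le_mul_of_nonneg_left ?_ (by have := sub_pos.mpr hα; positivity)
    exact Real.logb_le_logb_of_le one_lt_two hpos
      (powerSum_le_of_lt_one h.p_nonneg hq h'.p_nonneg hq' hF h0 hα)
  · refine mul_le_mul_of_nonpos_left ?_ (one_div_neg.mpr (by linarith)).le
    refine Real.logb_le_logb_of_le one_lt_two hpos' ?_
    have hlt : ∀ β : ℝ, 1 < β → β < 2 → powerSum w' p' q' β ≤ powerSum w p q β := fun β hβ hβ2 =>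
      powerSum_le_of_one_lt h.p_nonneg hq h'.p_nonneg hq'
        (h.sum_eq_one.trans h'.sum_eq_one.symm) hF hβ hβ2
    rcases h2.lt_or_eq with h2 | rfl
    · exact hlt α hα h2
    -- The integral representation requires `α - 1 < 1`; the endpoint `α = 2` is reached from the
    -- left.
    · refine le_of_tendsto_of_tendsto
        ((continuousAt_powerSum hq' two_ne_zero).tendsto.mono_left
          (nhdsWithin_le_nhds (s := Set.Iio 2)))
        ((continuousAt_powerSum hq two_ne_zero).tendsto.mono_left nhdsWithin_le_nhds) ?_
      filter_upwards [self_mem_nhdsWithin,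
        nhdsWithin_le_nhds (eventually_gt_nhds one_lt_two)] with β hβ hβ1
      exact hlt β hβ1 hβ

end IsSpectralPair

end ScalarLimits


/-! ### Kraus operators, the Schwarz inequality and monotonicity of the parallel sum. -/

section Kraus

variable {A B C : Type*} [Fintype A] [Fintype B] [Fintype C]
  [DecidableEq A] [DecidableEq B] [DecidableEq C]

lemma _root_.Matrix.PosSemidef.exists_conjTranspose_mul_self {X : Matrix A A ℂ}
    (hX : X.PosSemidef) : ∃ N : Matrix A A ℂ, X = N.conjTranspose * N := by
  set U := (hX.isHermitian.eigenvectorUnitary : Matrix A A ℂ) with hU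
  set D : Matrix A A ℂ := Matrix.diagonal fun i => (Real.sqrt (hX.isHermitian.eigenvalues i) : ℂ)
    with hD
  refine ⟨D * star U, ?_⟩
  have hDD : D.conjTranspose * D =
      Matrix.diagonal fun i => (hX.isHermitian.eigenvalues i : ℂ) := by
    rw [hD, Matrix.diagonal_conjTranspose, Matrix.diagonal_mul_diagonal]
    congr 1
    funext i
    simp only [Pi.star_apply, Complex.star_def, Complex.conj_ofReal]
    rw [← Complex.ofReal_mul, Real.mul_self_sqrt (hX.eigenvalues_nonneg i)]
  rw [Matrix.conjTranspose_mul, ← Matrix.star_eq_conjTranspose (star U), star_star,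
    show U * D.conjTranspose * (D * star U) = U * (D.conjTranspose * D) * star U by
      simp only [mul_assoc], hDD]
  exact eq_conj_diagonal hX.isHermitian

lemma trace_sum_mul_mul_conjTranspose {ι : Type*} [Fintype ι] {L : ι → Matrix C B ℂ}
    (hL : ∑ i, (L i).conjTranspose * L i = 1) (X : Matrix B B ℂ) :
    (∑ i, L i * X * (L i).conjTranspose).trace = X.trace := by
  rw [Matrix.trace_sum]
  calc ∑ i, (L i * X * (L i).conjTranspose).trace
      = ∑ i, ((L i).conjTranspose * L i * X).trace := Finset.sum_congr rfl fun i _ => by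
        rw [Matrix.trace_mul_comm, Matrix.mul_assoc]
    _ = X.trace := by rw [← Matrix.trace_sum, ← Finset.sum_mul, hL, one_mul]

/-- **Kraus representation** of a trace-preserving completely positive map. -/
lemma IsTPCPM.exists_kraus {E : Matrix B B ℂ →ₗ[ℂ] Matrix C C ℂ} (hE : IsTPCPM E) :
    ∃ K : Fin (Fintype.card B) × C → Matrix C B ℂ,
      (∀ X, E X = ∑ i, K i * X * (K i).conjTranspose) ∧
        ∑ i, (K i).conjTranspose * K i = 1 := by
  set e := (Fintype.equivFin B).symm with he
  -- The unnormalised maximally entangled vector. The ampliation of its projector is the Choi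
  -- matrix, with blocks `E (single b b' 1)`; the conjugated rows of a factor `N` of it are the
  -- Kraus operators.
  set v : Fin (Fintype.card B) × B → ℂ := fun x => if e x.1 = x.2 then 1 else 0 with hv
  have hJ := hE.completelyPositive _ _ (Matrix.posSemidef_vecMulVec_self_star v)
  obtain ⟨N, hN⟩ := hJ.exists_conjTranspose_mul_self
  have hNe : ∀ b b' c c', E (Matrix.single b b' 1) c c' =
      ∑ i, star (N i (e.symm b, c)) * N i (e.symm b', c') := by
    intro b b' c c'
    have := congrFun (congrFun hN (e.symm b, c)) (e.symm b', c')
    rw [Matrix.mul_apply] at this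
    simp only [Matrix.conjTranspose_apply] at this
    have hs : Matrix.single b b' (1 : ℂ) = Matrix.of fun x y =>
        Matrix.vecMulVec v (star v) (e.symm b, x) (e.symm b', y) := by
      ext x y
      simp only [Matrix.single_apply, Matrix.vecMulVec_apply, Matrix.of_apply, hv, Pi.star_apply,
        Equiv.apply_symm_apply]
      split_ifs <;> simp_all
    rw [← this, hs]
    rfl
  set K : Fin (Fintype.card B) × C → Matrix C B ℂ := fun i =>
    Matrix.of fun c b => star (N i (e.symm b, c)) with hK
  have hrep : ∀ X, E X = ∑ i, K i * X * (K i).conjTranspose := by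
    intro X
    conv_lhs => rw [Matrix.matrix_eq_sum_single X]
    ext c c'
    simp only [map_sum, Matrix.sum_apply]
    have h1 : ∀ b b', E (Matrix.single b b' (X b b')) c c' =
        ∑ i, K i c b * X b b' * star (K i c' b') := by
      intro b b'
      have : Matrix.single b b' (X b b') = X b b' • Matrix.single b b' (1 : ℂ) := by
        rw [Matrix.smul_single, smul_eq_mul, mul_one]
      rw [this, map_smul, Matrix.smul_apply, hNe, smul_eq_mul, Finset.mul_sum]
      refine Finset.sum_congr rfl fun i _ => ?_
      simp only [hK, Matrix.of_apply, star_star]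
      ring
    simp only [h1, Matrix.mul_apply, Matrix.conjTranspose_apply, Finset.sum_mul]
    rw [Finset.sum_comm' (t' := Finset.univ) (s' := fun _ => Finset.univ) (by simp)]
    simp only [Finset.sum_comm (γ := B) (α := Fin (Fintype.card B) × C)]
  refine ⟨K, hrep, ?_⟩
  rw [Matrix.ext_iff_trace_mul_right]
  intro X
  rw [one_mul, ← hE.trace_map X, hrep X, Finset.sum_mul, Matrix.trace_sum, Matrix.trace_sum]
  refine Finset.sum_congr rfl fun i _ => ?_
  rw [Matrix.trace_mul_comm (K i * X), Matrix.mul_assoc]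

lemma ampliation_eq_sum {ι : Type*} [Fintype ι] {E : Matrix B B ℂ →ₗ[ℂ] Matrix C C ℂ}
    {K : ι → Matrix C B ℂ} (hK : ∀ X, E X = ∑ i, K i * X * (K i).conjTranspose)
    (X : Matrix (A × B) (A × B) ℂ) :
    ampliation A E X =
      ∑ i, ((1 : Matrix A A ℂ) ⊗ₖ K i) * X * ((1 : Matrix A A ℂ) ⊗ₖ K i).conjTranspose := by
  ext ⟨a, c⟩ ⟨a', c'⟩
  simp only [ampliation, Matrix.of_apply, hK, Matrix.sum_apply]
  refine Finset.sum_congr rfl fun i _ => ?_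
  simp only [Matrix.mul_apply, Fintype.sum_prod_type, Matrix.kroneckerMap_apply, Matrix.one_apply,
    Matrix.conjTranspose_apply, Matrix.of_apply]
  rw [Finset.sum_comm (γ := A)]
  simp [apply_ite (starRingEnd ℂ)]

lemma sum_one_kronecker_eq_one {ι : Type*} [Fintype ι] {K : ι → Matrix C B ℂ}
    (hK : ∑ i, (K i).conjTranspose * K i = 1) :
    ∑ i, ((1 : Matrix A A ℂ) ⊗ₖ K i).conjTranspose * ((1 : Matrix A A ℂ) ⊗ₖ K i) = 1 := by
  have h : ∀ i, ((1 : Matrix A A ℂ) ⊗ₖ K i).conjTranspose * ((1 : Matrix A A ℂ) ⊗ₖ K i) =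
      (1 : Matrix A A ℂ) ⊗ₖ ((K i).conjTranspose * K i) := fun i => by
    rw [Matrix.conjTranspose_kronecker, ← Matrix.mul_kronecker_mul, Matrix.conjTranspose_one,
      one_mul]
  simp only [h]
  rw [← Matrix.one_kronecker_one, ← hK]
  ext ⟨a, b⟩ ⟨a', b'⟩
  simp [Matrix.sum_apply, Matrix.kroneckerMap_apply, Finset.mul_sum]

lemma sum_one_kronecker_conj {ι : Type*} [Fintype ι] {E : Matrix B B ℂ →ₗ[ℂ] Matrix C C ℂ}
    {K : ι → Matrix C B ℂ} (hK : ∀ X, E X = ∑ i, K i * X * (K i).conjTranspose)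
    (X : Matrix B B ℂ) :
    ∑ i, ((1 : Matrix A A ℂ) ⊗ₖ K i) * ((1 : Matrix A A ℂ) ⊗ₖ X) *
      ((1 : Matrix A A ℂ) ⊗ₖ K i).conjTranspose = (1 : Matrix A A ℂ) ⊗ₖ E X := by
  have h : ∀ i, ((1 : Matrix A A ℂ) ⊗ₖ K i) * ((1 : Matrix A A ℂ) ⊗ₖ X) *
      ((1 : Matrix A A ℂ) ⊗ₖ K i).conjTranspose =
        (1 : Matrix A A ℂ) ⊗ₖ (K i * X * (K i).conjTranspose) := fun i => by
    rw [Matrix.conjTranspose_kronecker, ← Matrix.mul_kronecker_mul, ← Matrix.mul_kronecker_mul,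
      Matrix.conjTranspose_one, one_mul, one_mul]
  simp only [h, hK]
  ext ⟨a, b⟩ ⟨a', b'⟩
  simp [Matrix.sum_apply, Matrix.kroneckerMap_apply, Finset.mul_sum]

lemma trace_mul_self_mul_star_nonneg {M : Matrix B B ℂ} (hM : M.PosSemidef) (D : Matrix B C ℂ) :
    0 ≤ ((M * (D * D.conjTranspose)).trace).re := by
  have h := (hM.conjTranspose_mul_mul_same D).trace_nonneg
  rw [Matrix.mul_assoc, Matrix.trace_mul_comm, Matrix.mul_assoc] at h
  exact (Complex.nonneg_iff.mp h).1

/-- The Schwarz inequality for the adjoint of a Kraus map, tested against `M`. -/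
lemma trace_kraus_adjoint_le {ι : Type*} [Fintype ι] {L : ι → Matrix C B ℂ}
    (hL : ∑ i, (L i).conjTranspose * L i = 1) {M : Matrix B B ℂ} (hM : M.PosSemidef)
    (Y : Matrix C C ℂ) :
    ((M * ((∑ i, (L i).conjTranspose * Y * L i) *
        star (∑ i, (L i).conjTranspose * Y * L i))).trace).re ≤
      (((∑ i, L i * M * (L i).conjTranspose) * (Y * star Y)).trace).re := by
  set Z := ∑ i, (L i).conjTranspose * Y * L i with hZ
  have hZ' : star Z = ∑ i, (L i).conjTranspose * star Y * L i := by
    rw [hZ, star_sum]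
    refine Finset.sum_congr rfl fun i _ => ?_
    simp only [Matrix.star_eq_conjTranspose, Matrix.conjTranspose_mul,
      Matrix.conjTranspose_conjTranspose, Matrix.mul_assoc]
  -- The Schwarz defect is a sum of squares; the cross terms collapse to `Z * star Z` because `∑ L*
  -- L = 1`.
  have hsum : ∑ i, ((L i).conjTranspose * Y - Z * (L i).conjTranspose) *
      ((L i).conjTranspose * Y - Z * (L i).conjTranspose).conjTranspose =
        (∑ i, (L i).conjTranspose * (Y * star Y) * L i) - Z * star Z := by
    have hi : ∀ i, ((L i).conjTranspose * Y - Z * (L i).conjTranspose) *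
        ((L i).conjTranspose * Y - Z * (L i).conjTranspose).conjTranspose =
          (L i).conjTranspose * (Y * star Y) * L i - ((L i).conjTranspose * Y * L i) * star Z -
            Z * ((L i).conjTranspose * star Y * L i) +
              Z * ((L i).conjTranspose * L i) * star Z := fun i => by
      simp only [Matrix.star_eq_conjTranspose, Matrix.conjTranspose_sub, Matrix.conjTranspose_mul,
        Matrix.conjTranspose_conjTranspose, Matrix.mul_sub, Matrix.sub_mul, Matrix.mul_assoc]
      abel
    simp only [hi, Finset.sum_add_distrib, Finset.sum_sub_distrib, ← Finset.sum_mul,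
      ← Finset.mul_sum, ← hZ, ← hZ', hL, mul_one]
    abel
  have hnn : 0 ≤ ((M * ∑ i, ((L i).conjTranspose * Y - Z * (L i).conjTranspose) *
      ((L i).conjTranspose * Y - Z * (L i).conjTranspose).conjTranspose).trace).re := by
    rw [Finset.mul_sum, Matrix.trace_sum, Complex.re_sum]
    exact Finset.sum_nonneg fun i _ => trace_mul_self_mul_star_nonneg hM _
  have hcyc : (M * ∑ i, (L i).conjTranspose * (Y * star Y) * L i).trace =
      ((∑ i, L i * M * (L i).conjTranspose) * (Y * star Y)).trace := by
    rw [Finset.mul_sum, Finset.sum_mul, Matrix.trace_sum, Matrix.trace_sum]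
    refine Finset.sum_congr rfl fun i _ => ?_
    rw [← Matrix.mul_assoc, Matrix.trace_mul_comm]
    simp only [Matrix.mul_assoc]
  rw [hsum, Matrix.mul_sub, Matrix.trace_sub, Complex.sub_re, hcyc] at hnn
  linarith

/-- Monotonicity of the parallel sum under trace-preserving completely positive maps. -/
lemma parallelSum_le_of_kraus {ι : Type*} [Fintype ι] {L : ι → Matrix C B ℂ}
    (hL : ∑ i, (L i).conjTranspose * L i = 1) {ρ M : Matrix B B ℂ} {τ W : Matrix C C ℂ}
    (hρ : ρ.PosSemidef) (hM : M.PosDef) (hτ : τ.PosSemidef) (hW : W.PosDef)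
    (hρτ : τ = ∑ i, L i * ρ * (L i).conjTranspose)
    (hMW : (W - ∑ i, L i * M * (L i).conjTranspose).PosSemidef) {l : ℝ} (hl : 0 < l) :
    parallelSum l hρ.isHermitian hM.isHermitian ≤ parallelSum l hτ.isHermitian hW.isHermitian := by
  obtain ⟨Y, hY⟩ := exists_parallelCost_eq hl hτ hW
  rw [← hY]
  refine (parallelSum_le_parallelCost hl hρ hM (∑ i, (L i).conjTranspose * Y * L i)).trans ?_
  refine add_le_add ?_ (mul_le_mul_of_nonneg_left ?_ hl.le)
  · refine (trace_kraus_adjoint_le hL hM.posSemidef Y).trans ?_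
    have := trace_mul_self_mul_star_nonneg hMW Y
    rw [Matrix.sub_mul, Matrix.trace_sub, Complex.sub_re] at this
    rw [Matrix.star_eq_conjTranspose]
    linarith
  -- The second term of the cost has the adjoint on the left, hence the `star`. Unitality of the
  -- adjoint map turns the pullback of `1 - Y` into `1` minus the pullback of `Y`.
  · have h := trace_kraus_adjoint_le hL hρ (star (1 - Y))
    have e : ∑ i, (L i).conjTranspose * star (1 - Y) * L i =
        star (1 - ∑ i, (L i).conjTranspose * Y * L i) := by
      rw [star_sub, star_one, star_sub, star_one, star_sum]
      simp only [Matrix.mul_sub, Matrix.sub_mul, Finset.sum_sub_distrib, Matrix.mul_one, hL]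
      congr 1
      refine Finset.sum_congr rfl fun i _ => ?_
      simp only [Matrix.star_eq_conjTranspose, Matrix.conjTranspose_mul,
        Matrix.conjTranspose_conjTranspose, Matrix.mul_assoc]
    rw [e, star_star, star_star, ← hρτ] at h
    exact h

lemma IsState.sum_mul_mul_conjTranspose {ι : Type*} [Fintype ι] {L : ι → Matrix C B ℂ}
    (hL : ∑ i, (L i).conjTranspose * L i = 1) {ρ : Matrix B B ℂ} (hρ : IsState ρ) :
    IsState (∑ i, L i * ρ * (L i).conjTranspose) where
  posSemidef := Matrix.posSemidef_sum _ fun i _ => hρ.posSemidef.mul_mul_conjTranspose_same (L i)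
  trace_eq_one := (trace_sum_mul_mul_conjTranspose hL ρ).trans hρ.trace_eq_one

lemma IsTPCPM.isState_map {E : Matrix B B ℂ →ₗ[ℂ] Matrix C C ℂ} (hE : IsTPCPM E)
    {σ : Matrix B B ℂ} (hσ : IsState σ) : IsState (E σ) := by
  obtain ⟨K, hK, hK1⟩ := hE.exists_kraus
  rw [hK]
  exact hσ.sum_mul_mul_conjTranspose hK1

lemma IsTPCPM.isState_ampliation {E : Matrix B B ℂ →ₗ[ℂ] Matrix C C ℂ} (hE : IsTPCPM E)
    {ρ : Matrix (A × B) (A × B) ℂ} (hρ : IsState ρ) : IsState (ampliation A E ρ) := by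
  obtain ⟨K, hK, hK1⟩ := hE.exists_kraus
  rw [ampliation_eq_sum hK]
  exact hρ.sum_mul_mul_conjTranspose (sum_one_kronecker_eq_one hK1)

lemma exists_smul_one_sub_posSemidef {X : Matrix B B ℂ} (hX : X.IsHermitian) :
    ∃ k : ℝ, 0 < k ∧ ((k : ℂ) • (1 : Matrix B B ℂ) - X).PosSemidef := by
  refine ⟨1 + ∑ i, |hX.eigenvalues i|, by positivity, ?_⟩
  set k : ℝ := 1 + ∑ i, |hX.eigenvalues i| with hk
  set U := (hX.eigenvectorUnitary : Matrix B B ℂ) with hU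
  have h : (k : ℂ) • (1 : Matrix B B ℂ) - X = U *
      Matrix.diagonal (fun i => ((k - hX.eigenvalues i : ℝ) : ℂ)) * U.conjTranspose := by
    have hd : Matrix.diagonal (fun i => ((k - hX.eigenvalues i : ℝ) : ℂ)) =
        (k : ℂ) • (1 : Matrix B B ℂ) - Matrix.diagonal fun i => (hX.eigenvalues i : ℂ) := by
      rw [Matrix.smul_one_eq_diagonal, Matrix.diagonal_sub]
      simp
    rw [hd, mul_sub, sub_mul, mul_smul_comm, mul_one, smul_mul_assoc,
      ← Matrix.star_eq_conjTranspose, hU, eigenvectorUnitary_mul_star_self,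
      ← eq_conj_diagonal hX]
  rw [h]
  refine Matrix.PosSemidef.mul_mul_conjTranspose_same ?_ U
  rw [Matrix.posSemidef_diagonal_iff]
  intro i
  rw [Complex.zero_le_real, sub_nonneg]
  have := Finset.single_le_sum (f := fun i => |hX.eigenvalues i|) (fun j _ => abs_nonneg _)
    (Finset.mem_univ i)
  have := le_abs_self (hX.eigenvalues i)
  linarith

end Kraus


/-! ### From spectral data back to the entropies. -/

section Link

variable {A B C : Type*} [Fintype A] [Fintype B] [Fintype C]
  [DecidableEq A] [DecidableEq B] [DecidableEq C]

/-- This keeps the eigenbasis of `X` fixed while `ξ` varies. Any `f` is allowed, as every function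
is continuous on a finite spectrum; the logarithm and negative powers need this. -/
lemma cfc_add_smul_one {X : Matrix B B ℂ} (hX : X.IsHermitian) (ξ : ℝ) (f : ℝ → ℝ) :
    cfc f (X + (ξ : ℂ) • (1 : Matrix B B ℂ)) = cfc (fun x => f (x + ξ)) X := by
  have hX' : IsSelfAdjoint X := hX
  have h : X + (ξ : ℂ) • (1 : Matrix B B ℂ) = cfc (fun x : ℝ => x + ξ) X := by
    rw [cfc_add_const ξ (fun x => x) X (by fun_prop) hX', cfc_id' ℝ X,
      Algebra.algebraMap_eq_smul_one]
    rfl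
  rw [h, cfc_comp' f (fun x => x + ξ) X ((X.finite_real_spectrum.image _).continuousOn f)
    (by fun_prop) hX']

/-- The homomorphism `X ↦ 1 ⊗ X`. -/
def oneKroneckerHom (A B : Type*) [Fintype A] [Fintype B] [DecidableEq A] [DecidableEq B] :
    Matrix B B ℂ →⋆ₐ[ℂ] Matrix (A × B) (A × B) ℂ where
  toFun X := (1 : Matrix A A ℂ) ⊗ₖ X
  map_one' := Matrix.one_kronecker_one
  map_mul' X Y := by rw [← Matrix.mul_kronecker_mul, one_mul]
  map_zero' := Matrix.kronecker_zero _
  map_add' X Y := Matrix.kronecker_add _ _ _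
  commutes' r := by
    rw [Algebra.algebraMap_eq_smul_one, Algebra.algebraMap_eq_smul_one, Matrix.kronecker_smul,
      Matrix.one_kronecker_one]
  map_star' X := by
    rw [Matrix.star_eq_conjTranspose, Matrix.star_eq_conjTranspose,
      Matrix.conjTranspose_kronecker, Matrix.conjTranspose_one]

lemma one_kronecker_cfc {X : Matrix B B ℂ} (hX : X.IsHermitian) (f : ℝ → ℝ) :
    (1 : Matrix A A ℂ) ⊗ₖ cfc f X = cfc f ((1 : Matrix A A ℂ) ⊗ₖ X) := by
  have hc : Continuous (oneKroneckerHom A B) :=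
    LinearMap.continuous_of_finiteDimensional (oneKroneckerHom A B).toAlgHom.toLinearMap
  have hX' : IsSelfAdjoint X := hX
  exact (oneKroneckerHom A B).map_cfc f X (X.finite_real_spectrum.continuousOn f) hc hX'
    (hX'.map _)

lemma one_kronecker_add_smul_one (σ : Matrix B B ℂ) (z : ℂ) :
    (1 : Matrix A A ℂ) ⊗ₖ (σ + z • (1 : Matrix B B ℂ)) =
      (1 : Matrix A A ℂ) ⊗ₖ σ + z • (1 : Matrix (A × B) (A × B) ℂ) := by
  rw [Matrix.kronecker_add, Matrix.kronecker_smul, Matrix.one_kronecker_one]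

lemma posSemidef_one_kronecker (A : Type*) [Fintype A] [DecidableEq A] {σ : Matrix B B ℂ}
    (hσ : σ.PosSemidef) : ((1 : Matrix A A ℂ) ⊗ₖ σ).PosSemidef :=
  Matrix.PosSemidef.one.kronecker hσ

lemma posDef_one_kronecker (A : Type*) [Fintype A] [DecidableEq A] {σ : Matrix B B ℂ}
    (hσ : σ.PosDef) : ((1 : Matrix A A ℂ) ⊗ₖ σ).PosDef :=
  Matrix.PosDef.one.kronecker hσ

section SpectralData

variable {n : Type*} [Fintype n] [DecidableEq n] {ρ M : Matrix n n ℂ}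

lemma isSpectralPair (hρ : IsState ρ) (hM : M.PosSemidef) :
    IsSpectralPair (eigenWeight hρ.posSemidef.isHermitian hM.isHermitian)
      (fun x => hρ.posSemidef.isHermitian.eigenvalues x.1)
      (fun x => hM.isHermitian.eigenvalues x.2) where
  w_nonneg := eigenWeight_nonneg _ _
  p_nonneg x := hρ.posSemidef.eigenvalues_nonneg _
  q_nonneg x := hM.eigenvalues_nonneg _
  sum_eq_one := by
    have h := trace_cfc_mul_cfc hρ.posSemidef.isHermitian hM.isHermitian (fun x => x) (fun _ => 1)
    have e1 : cfc (fun x : ℝ => x) ρ = ρ := cfc_id' ℝ ρ hρ.posSemidef.isHermitian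
    have e2 : cfc (fun _ : ℝ => (1 : ℝ)) M = 1 := cfc_const_one ℝ M hM.isHermitian
    rw [e1, e2, mul_one, hρ.trace_eq_one] at h
    simpa using h.symm

end SpectralData

variable {ρ : Matrix (A × B) (A × B) ℂ} {σ : Matrix B B ℂ}

lemma alphaEntropyInv_add_eq (hρ : ρ.IsHermitian)
    (hM : ((1 : Matrix A A ℂ) ⊗ₖ σ).IsHermitian) (α ξ : ℝ) :
    alphaEntropyInv α ρ (σ + (ξ : ℂ) • (1 : Matrix B B ℂ)) =
      alphaScalar (eigenWeight hρ hM) (fun x => hρ.eigenvalues x.1)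
        (fun x => hM.eigenvalues x.2 + ξ) α := by
  rw [alphaEntropyInv, one_kronecker_add_smul_one, mpow, mpow, cfc_add_smul_one hM,
    trace_cfc_mul_cfc hρ hM]
  rfl

lemma alphaEntropyInv_eq (hρ : ρ.IsHermitian)
    (hM : ((1 : Matrix A A ℂ) ⊗ₖ σ).IsHermitian) (α : ℝ) :
    alphaEntropyInv α ρ σ = alphaScalar (eigenWeight hρ hM) (fun x => hρ.eigenvalues x.1)
        (fun x => hM.eigenvalues x.2) α := by
  rw [alphaEntropyInv, mpow, mpow, trace_cfc_mul_cfc hρ hM]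
  rfl

lemma condVonNeumannInv_add_eq (hρ : ρ.IsHermitian) (hσ : σ.IsHermitian)
    (hM : ((1 : Matrix A A ℂ) ⊗ₖ σ).IsHermitian) (ξ : ℝ) :
    condVonNeumannInv ρ (σ + (ξ : ℂ) • (1 : Matrix B B ℂ)) =
      logScalar (eigenWeight hρ hM) (fun x => hρ.eigenvalues x.1)
        (fun x => hM.eigenvalues x.2 + ξ) := by
  have hρ' : IsSelfAdjoint ρ := hρ
  have hM' : IsSelfAdjoint ((1 : Matrix A A ℂ) ⊗ₖ σ) := hM
  have e1 : ρ * ((1 : Matrix A A ℂ) ⊗ₖ mlog (σ + (ξ : ℂ) • (1 : Matrix B B ℂ))) =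
      cfc (fun x : ℝ => x) ρ *
        cfc (fun x => Real.logb 2 (x + ξ)) ((1 : Matrix A A ℂ) ⊗ₖ σ) := by
    rw [mlog, cfc_add_smul_one hσ, one_kronecker_cfc hσ, cfc_id' ℝ ρ hρ']
  -- The trivial factor `cfc 1 = 1` expresses this trace with the same weights as the other one.
  have e2 : ρ * mlog ρ = cfc (fun x : ℝ => x * Real.logb 2 x) ρ *
      cfc (fun _ : ℝ => (1 : ℝ)) ((1 : Matrix A A ℂ) ⊗ₖ σ) := by
    rw [cfc_const_one ℝ _ hM', mul_one, mlog,
      cfc_mul (fun x : ℝ => x) (Real.logb 2) ρ (by fun_prop)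
        (ρ.finite_real_spectrum.continuousOn _), cfc_id' ℝ ρ hρ']
  rw [condVonNeumannInv, mul_sub, Matrix.trace_sub, Complex.sub_re, e1, e2,
    trace_cfc_mul_cfc hρ hM, trace_cfc_mul_cfc hρ hM, ← Finset.sum_sub_distrib]
  refine Finset.sum_congr rfl fun x _ => ?_
  ring

/-- The value of the `α`-entropy in terms of spectral data. -/
def spectralAlphaEntropy (hρ : IsState ρ) (hσ : IsState σ) : ℝ → EReal :=
  alphaLimit (eigenWeight hρ.posSemidef.isHermitian
      (posSemidef_one_kronecker A hσ.posSemidef).isHermitian)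
    (fun x => hρ.posSemidef.isHermitian.eigenvalues x.1)
    (fun x => (posSemidef_one_kronecker A hσ.posSemidef).isHermitian.eigenvalues x.2)

lemma tendsto_alphaEntropyInv_spectral (hρ : IsState ρ) (hσ : IsState σ) {α : ℝ} (h0 : 0 < α)
    (h1 : α ≠ 1) :
    Tendsto (fun ξ : ℝ => (alphaEntropyInv α ρ (σ + (ξ : ℂ) • (1 : Matrix B B ℂ)) : EReal))
      (𝓝[>] 0) (𝓝 (spectralAlphaEntropy hρ hσ α)) := by
  have h := (isSpectralPair hρ
    (posSemidef_one_kronecker A hσ.posSemidef)).tendsto_alphaScalar_add h0 h1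
  refine h.congr fun ξ => ?_
  rw [alphaEntropyInv_add_eq]

lemma alphaEntropyGeneric_eq (hρ : IsState ρ) (hσ : IsState σ) {α : ℝ} (h0 : 0 < α)
    (h1 : α ≠ 1) : alphaEntropyGeneric α ρ σ = spectralAlphaEntropy hρ hσ α := by
  unfold alphaEntropyGeneric
  split_ifs with hu
  · have hpd : σ.PosDef := hσ.posSemidef.posDef_iff_isUnit.mpr hu
    rw [spectralAlphaEntropy, (isSpectralPair hρ
      (posSemidef_one_kronecker A hσ.posSemidef)).alphaLimit_of_pos
        (fun x => (posDef_one_kronecker A hpd).eigenvalues_pos _)]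
    rw [alphaEntropyInv_eq]
  · exact (tendsto_alphaEntropyInv_spectral hρ hσ h0 h1).limUnder_eq

lemma condAlphaEntropy_eq_generic {α : ℝ} (h0 : 0 < α) (h1 : α ≠ 1) :
    condAlphaEntropy α ρ σ = alphaEntropyGeneric α ρ σ := by
  rw [condAlphaEntropy, if_neg h0.ne', if_neg h1]

lemma tendsto_alphaEntropyInv (hρ : IsState ρ) (hσ : IsState σ) {α : ℝ} (h0 : 0 < α)
    (h1 : α ≠ 1) :
    Tendsto (fun ξ : ℝ => (alphaEntropyInv α ρ (σ + (ξ : ℂ) • (1 : Matrix B B ℂ)) : EReal))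
      (𝓝[>] 0) (𝓝 (condAlphaEntropy α ρ σ)) := by
  rw [condAlphaEntropy_eq_generic h0 h1, alphaEntropyGeneric_eq hρ hσ h0 h1]
  exact tendsto_alphaEntropyInv_spectral hρ hσ h0 h1

lemma eventually_generic_zero (ρ : Matrix (A × B) (A × B) ℂ) (σ : Matrix B B ℂ) :
    ∀ᶠ α : ℝ in 𝓝[>] 0, alphaEntropyGeneric α ρ σ = condAlphaEntropy α ρ σ := by
  filter_upwards [self_mem_nhdsWithin, nhdsWithin_le_nhds (eventually_lt_nhds one_pos)]
    with α h0 h1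
  exact (condAlphaEntropy_eq_generic h0 (ne_of_lt h1)).symm

lemma eventually_generic_one (ρ : Matrix (A × B) (A × B) ℂ) (σ : Matrix B B ℂ) :
    ∀ᶠ α : ℝ in 𝓝[≠] 1, alphaEntropyGeneric α ρ σ = condAlphaEntropy α ρ σ := by
  filter_upwards [self_mem_nhdsWithin, nhdsWithin_le_nhds (eventually_gt_nhds one_pos)]
    with α h1 h0
  exact (condAlphaEntropy_eq_generic h0 h1).symm

lemma tendsto_condAlphaEntropy_zero (hρ : IsState ρ) (hσ : IsState σ) :
    Tendsto (fun α : ℝ => condAlphaEntropy α ρ σ) (𝓝[>] 0) (𝓝 (condAlphaEntropy 0 ρ σ)) := by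
  obtain ⟨L, hL⟩ := (isSpectralPair hρ
    (posSemidef_one_kronecker A hσ.posSemidef)).exists_tendsto_alphaLimit_zero
  have hg : Tendsto (fun α : ℝ => alphaEntropyGeneric α ρ σ) (𝓝[>] 0) (𝓝 L) := by
    refine hL.congr' ?_
    filter_upwards [self_mem_nhdsWithin, nhdsWithin_le_nhds (eventually_lt_nhds one_pos)]
      with α h0 h1
    exact (alphaEntropyGeneric_eq hρ hσ h0 (ne_of_lt h1)).symm
  have e : condAlphaEntropy 0 ρ σ = L := by
    rw [condAlphaEntropy, if_pos rfl]
    exact hg.limUnder_eq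
  rw [e]
  exact hg.congr' (eventually_generic_zero ρ σ)

lemma tendsto_generic_one (hρ : IsState ρ) (hσ : IsState σ) :
    Tendsto (fun α : ℝ => alphaEntropyGeneric α ρ σ) (𝓝[≠] 1) (𝓝 (condVonNeumann ρ σ)) := by
  have hs := isSpectralPair hρ (posSemidef_one_kronecker A hσ.posSemidef)
  have hv : condVonNeumann ρ σ = logLimit _ _ _ :=
    (hs.tendsto_logScalar_add.congr fun ξ => by
      rw [condVonNeumannInv_add_eq _ hσ.posSemidef.isHermitian]).limUnder_eq
  rw [hv]
  refine hs.tendsto_alphaLimit_one.congr' ?_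
  filter_upwards [self_mem_nhdsWithin, nhdsWithin_le_nhds (eventually_gt_nhds one_pos)]
    with α h1 h0
  exact (alphaEntropyGeneric_eq hρ hσ h0 h1).symm

lemma tendsto_condVonNeumannInv (hρ : IsState ρ) (hσ : IsState σ) :
    Tendsto (fun ξ : ℝ => (condVonNeumannInv ρ (σ + (ξ : ℂ) • (1 : Matrix B B ℂ)) : EReal))
      (𝓝[>] 0) (𝓝 (condVonNeumann ρ σ)) := by
  have h : Tendsto (fun ξ : ℝ =>
      (condVonNeumannInv ρ (σ + (ξ : ℂ) • (1 : Matrix B B ℂ)) : EReal)) (𝓝[>] 0) _ :=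
    (isSpectralPair hρ (posSemidef_one_kronecker A hσ.posSemidef)).tendsto_logScalar_add.congr
      fun ξ => by rw [condVonNeumannInv_add_eq _ hσ.posSemidef.isHermitian]
  have e : condVonNeumann ρ σ = _ := h.limUnder_eq
  rw [e]
  exact h

lemma condAlphaEntropy_one_eq (hρ : IsState ρ) (hσ : IsState σ) :
    condAlphaEntropy 1 ρ σ = condVonNeumann ρ σ := by
  rw [condAlphaEntropy, if_neg one_ne_zero, if_pos rfl]
  exact (tendsto_generic_one hρ hσ).limUnder_eq

lemma tendsto_condAlphaEntropy_one (hρ : IsState ρ) (hσ : IsState σ) :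
    Tendsto (fun α : ℝ => condAlphaEntropy α ρ σ) (𝓝[≠] 1) (𝓝 (condAlphaEntropy 1 ρ σ)) := by
  rw [condAlphaEntropy_one_eq hρ hσ]
  exact (tendsto_generic_one hρ hσ).congr' (eventually_generic_one ρ σ)

/-! ### Data processing. -/

/-- Only `E σ ≤ ω` is needed, since the cost is monotone in `M`. This slack absorbs the
regularisation: `E σ` may be singular even for invertible `σ`, and `E` need not be unital. -/
lemma alphaEntropyInv_le {E : Matrix B B ℂ →ₗ[ℂ] Matrix C C ℂ} (hE : IsTPCPM E)
    (hρ : IsState ρ) (hσ : σ.PosDef) {ω : Matrix C C ℂ} (hω : ω.PosDef)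
    (hle : (ω - E σ).PosSemidef) {α : ℝ} (h0 : 0 < α) (h1 : α ≠ 1) (h2 : α ≤ 2) :
    alphaEntropyInv α ρ σ ≤ alphaEntropyInv α (ampliation A E ρ) ω := by
  obtain ⟨K, hK, hK1⟩ := hE.exists_kraus
  have hτ := hE.isState_ampliation hρ
  have hM := posDef_one_kronecker A hσ
  have hW := posDef_one_kronecker A hω
  rw [alphaEntropyInv_eq hρ.posSemidef.isHermitian hM.isHermitian,
    alphaEntropyInv_eq hτ.posSemidef.isHermitian hW.isHermitian]
  refine (isSpectralPair hρ hM.posSemidef).alphaScalar_le (isSpectralPair hτ hW.posSemidef)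
    (fun x => hM.eigenvalues_pos _) (fun x => hW.eigenvalues_pos _) (fun l hl => ?_) h0 h1 h2
  refine parallelSum_le_of_kraus (sum_one_kronecker_eq_one hK1) hρ.posSemidef hM
    hτ.posSemidef hW (ampliation_eq_sum hK ρ) ?_ hl
  rw [sum_one_kronecker_conj hK]
  have e : (1 : Matrix A A ℂ) ⊗ₖ ω - (1 : Matrix A A ℂ) ⊗ₖ E σ =
      (1 : Matrix A A ℂ) ⊗ₖ (ω - E σ) := (map_sub (oneKroneckerHom A C) _ _).symm
  rw [e]
  exact posSemidef_one_kronecker A hle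

lemma posDef_add_smul_one (hσ : σ.PosSemidef) {ξ : ℝ} (hξ : 0 < ξ) :
    (σ + (ξ : ℂ) • (1 : Matrix B B ℂ)).PosDef :=
  Matrix.PosDef.posSemidef_add hσ (Matrix.PosDef.one.smul (Complex.zero_lt_real.mpr hξ))

lemma condAlphaEntropy_le_of_ne {E : Matrix B B ℂ →ₗ[ℂ] Matrix C C ℂ} (hE : IsTPCPM E)
    (hρ : IsState ρ) (hσ : IsState σ) {α : ℝ} (h0 : 0 < α) (h1 : α ≠ 1) (h2 : α ≤ 2) :
    condAlphaEntropy α ρ σ ≤ condAlphaEntropy α (ampliation A E ρ) (E σ) := by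
  obtain ⟨K, hK, -⟩ := hE.exists_kraus
  have hE1 : (E 1).PosSemidef := by
    rw [hK]
    exact Matrix.posSemidef_sum _ fun i _ =>
      Matrix.PosSemidef.one.mul_mul_conjTranspose_same (K i)
  -- With `E 1 ≤ k 1`, regularising the output by `k ξ` dominates the image of `σ + ξ 1`; as `k >
  -- 0`, `k ξ ↓ 0` gives the same limit.
  obtain ⟨k, hk, hk1⟩ := exists_smul_one_sub_posSemidef hE1.isHermitian
  have hω := hE.isState_map hσ
  have hkξ : Tendsto (fun ξ : ℝ => k * ξ) (𝓝[>] 0) (𝓝[>] 0) := by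
    refine tendsto_nhdsWithin_iff.mpr ⟨?_, ?_⟩
    · have : Tendsto (fun ξ : ℝ => k * ξ) (𝓝 0) (𝓝 (k * 0)) :=
        (continuous_const.mul continuous_id).tendsto 0
      rw [mul_zero] at this
      exact this.mono_left nhdsWithin_le_nhds
    · filter_upwards [self_mem_nhdsWithin] with ξ hξ
      exact mul_pos hk hξ
  refine le_of_tendsto_of_tendsto (tendsto_alphaEntropyInv hρ hσ h0 h1)
    ((tendsto_alphaEntropyInv (hE.isState_ampliation hρ) hω h0 h1).comp hkξ) ?_
  filter_upwards [self_mem_nhdsWithin] with ξ hξ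
  refine EReal.coe_le_coe_iff.mpr (alphaEntropyInv_le hE hρ (posDef_add_smul_one hσ.posSemidef hξ)
    (posDef_add_smul_one hω.posSemidef (mul_pos hk hξ)) ?_ h0 h1 h2)
  have e : E σ + ((k * ξ : ℝ) : ℂ) • (1 : Matrix C C ℂ) - E (σ + (ξ : ℂ) • (1 : Matrix B B ℂ)) =
      (ξ : ℂ) • ((k : ℂ) • (1 : Matrix C C ℂ) - E 1) := by
    rw [map_add, map_smul, smul_sub, smul_smul, Complex.ofReal_mul, mul_comm (k : ℂ)]
    abel
  rw [e]
  exact hk1.smul (Complex.zero_le_real.mpr (le_of_lt hξ))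

/-- **Data processing inequality** for the conditional `α`-entropies, `0 ≤ α ≤ 2`. -/
theorem condAlphaEntropy_le {E : Matrix B B ℂ →ₗ[ℂ] Matrix C C ℂ} (hE : IsTPCPM E)
    (hρ : IsState ρ) (hσ : IsState σ) {α : ℝ} (h0 : 0 ≤ α) (h2 : α ≤ 2) :
    condAlphaEntropy α ρ σ ≤ condAlphaEntropy α (ampliation A E ρ) (E σ) := by
  have hτ := hE.isState_ampliation hρ
  have hω := hE.isState_map hσ
  rcases h0.eq_or_lt with rfl | h0
  · refine le_of_tendsto_of_tendsto (tendsto_condAlphaEntropy_zero hρ hσ)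
      (tendsto_condAlphaEntropy_zero hτ hω) ?_
    filter_upwards [self_mem_nhdsWithin, nhdsWithin_le_nhds (eventually_lt_nhds one_pos)]
      with α h0 h1
    exact condAlphaEntropy_le_of_ne hE hρ hσ h0 (ne_of_lt h1) (by linarith)
  · by_cases h1 : α = 1
    · subst h1
      refine le_of_tendsto_of_tendsto (tendsto_condAlphaEntropy_one hρ hσ)
        (tendsto_condAlphaEntropy_one hτ hω) ?_
      filter_upwards [self_mem_nhdsWithin, nhdsWithin_le_nhds (eventually_gt_nhds one_pos),
        nhdsWithin_le_nhds (eventually_lt_nhds one_lt_two)] with α h1 h0 h2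
      exact condAlphaEntropy_le_of_ne hE hρ hσ h0 h1 h2.le
    · exact condAlphaEntropy_le_of_ne hE hρ hσ h0 h1 h2

/-! ### Marginals and strong subadditivity. -/

lemma trace_mul_one_kronecker (ρ : Matrix (A × B) (A × B) ℂ) (G : Matrix B B ℂ) :
    (ρ * ((1 : Matrix A A ℂ) ⊗ₖ G)).trace = (traceFst A B ρ * G).trace := by
  simp only [Matrix.trace, Matrix.diag_apply, Matrix.mul_apply, Fintype.sum_prod_type,
    Matrix.kroneckerMap_apply, Matrix.one_apply, traceFst, LinearMap.coe_mk, AddHom.coe_mk,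
    Matrix.of_apply, Finset.sum_mul]
  rw [Finset.sum_comm]
  refine Finset.sum_congr rfl fun b _ => ?_
  refine (Finset.sum_congr rfl fun a _ => ?_).trans Finset.sum_comm
  rw [Finset.sum_comm]
  simp

lemma isState_traceFst (hρ : IsState ρ) : IsState (traceFst A B ρ) where
  posSemidef := by
    have e : traceFst A B ρ = ∑ a, ρ.submatrix (fun b => (a, b)) (fun b => (a, b)) := by
      ext b b'
      simp [traceFst, Matrix.sum_apply]
    rw [e]
    exact Matrix.posSemidef_sum _ fun a _ => hρ.posSemidef.submatrix _
  trace_eq_one := by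
    rw [← mul_one (traceFst A B ρ), ← trace_mul_one_kronecker, Matrix.one_kronecker_one, mul_one,
      hρ.trace_eq_one]

/-- Zero eigenvalues contribute `0 · log ξ = 0` for every `ξ`, so the limit stays finite without
assuming invertibility. -/
lemma tendsto_trace_mul_mlog_add (hσ : σ.PosSemidef) :
    Tendsto (fun ξ : ℝ => ((σ * mlog (σ + (ξ : ℂ) • (1 : Matrix B B ℂ))).trace).re)
      (𝓝[>] 0) (𝓝 (((σ * mlog σ).trace).re)) := by
  have hσ' : IsSelfAdjoint σ := hσ.isHermitian
  have key : ∀ f : ℝ → ℝ, ((σ * cfc f σ).trace).re =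
      ∑ x, eigenWeight hσ.isHermitian hσ.isHermitian x *
        (hσ.isHermitian.eigenvalues x.1 * f (hσ.isHermitian.eigenvalues x.1)) * 1 := fun f => by
    rw [← trace_cfc_mul_cfc hσ.isHermitian hσ.isHermitian (fun x => x * f x) (fun _ => 1),
      cfc_const_one ℝ σ hσ', mul_one, cfc_mul (fun x : ℝ => x) f σ (by fun_prop)
        (σ.finite_real_spectrum.continuousOn _), cfc_id' ℝ σ hσ']
  simp only [mlog, cfc_add_smul_one hσ.isHermitian, key]
  refine tendsto_finsetSum _ fun x _ => Tendsto.mul_const _ (Tendsto.const_mul _ ?_)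
  rcases eq_or_ne (hσ.isHermitian.eigenvalues x.1) 0 with h | h
  · simp [h]
  · exact ((IsSpectralPair.tendsto_add_const _).logb h).const_mul _

lemma condVonNeumann_traceFst (hρ : IsState ρ) :
    condVonNeumann ρ (traceFst A B ρ) =
      ((vonNeumannEntropy ρ - vonNeumannEntropy (traceFst A B ρ) : ℝ) : EReal) := by
  refine Tendsto.limUnder_eq (EReal.tendsto_coe.mpr ?_)
  have h := (tendsto_trace_mul_mlog_add (isState_traceFst hρ).posSemidef).sub_const
    ((ρ * mlog ρ).trace).re
  have e : vonNeumannEntropy ρ - vonNeumannEntropy (traceFst A B ρ) =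
      ((traceFst A B ρ * mlog (traceFst A B ρ)).trace).re - ((ρ * mlog ρ).trace).re := by
    rw [vonNeumannEntropy, vonNeumannEntropy]
    ring
  rw [e]
  refine h.congr fun ξ => ?_
  rw [condVonNeumannInv, mul_sub, Matrix.trace_sub, Complex.sub_re, trace_mul_one_kronecker]

lemma isTPCPM_traceSnd : IsTPCPM (traceSnd B C) where
  trace_map X := by
    simp [Matrix.trace, traceSnd, Fintype.sum_prod_type]
  completelyPositive k X hX := by
    have e : ampliation (Fin k) (traceSnd B C) X =
        ∑ c, X.submatrix (fun x : Fin k × B => (x.1, (x.2, c))) (fun x => (x.1, (x.2, c))) := by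
      ext x y
      simp [ampliation, traceSnd, Matrix.sum_apply]
    rw [e]
    exact Matrix.posSemidef_sum _ fun c _ => hX.submatrix _

lemma traceFst_ampliation_traceSnd (ρ : Matrix (A × (B × C)) (A × (B × C)) ℂ) :
    traceFst A B (ampliation A (traceSnd B C) ρ) = traceSnd B C (traceFst A (B × C) ρ) := by
  ext b b'
  simp only [traceFst, traceSnd, ampliation, LinearMap.coe_mk, AddHom.coe_mk, Matrix.of_apply]
  exact Finset.sum_comm

end Link

end QuantumEntropy

end

theorem mainTheorem5 {A B C : Type*} [Fintype A] [Fintype B] [Fintype C]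
    [DecidableEq A] [DecidableEq B] [DecidableEq C] :
    -- all limits that define the entropies exist, and `H_1` is the von Neumann entropy
    (∀ (ρ : Matrix (A × B) (A × B) ℂ) (σ : Matrix B B ℂ),
      QuantumEntropy.IsState ρ → QuantumEntropy.IsState σ →
      (∀ α : ℝ, 0 < α → α ≠ 1 →
        Tendsto (fun ξ : ℝ => ((QuantumEntropy.alphaEntropyInv α ρ
            (σ + (ξ : ℂ) • (1 : Matrix B B ℂ)) : ℝ) : EReal))
          (𝓝[>] 0) (𝓝 (QuantumEntropy.condAlphaEntropy α ρ σ))) ∧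
      Tendsto (fun α : ℝ => QuantumEntropy.condAlphaEntropy α ρ σ)
        (𝓝[>] 0) (𝓝 (QuantumEntropy.condAlphaEntropy 0 ρ σ)) ∧
      Tendsto (fun α : ℝ => QuantumEntropy.condAlphaEntropy α ρ σ)
        (𝓝[≠] 1) (𝓝 (QuantumEntropy.condAlphaEntropy 1 ρ σ)) ∧
      Tendsto (fun ξ : ℝ => ((QuantumEntropy.condVonNeumannInv ρ
            (σ + (ξ : ℂ) • (1 : Matrix B B ℂ)) : ℝ) : EReal))
          (𝓝[>] 0) (𝓝 (QuantumEntropy.condVonNeumann ρ σ)) ∧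
      QuantumEntropy.condAlphaEntropy 1 ρ σ = QuantumEntropy.condVonNeumann ρ σ) ∧
    -- data processing
    (∀ α ∈ Set.Icc (0 : ℝ) 2, ∀ (ρ : Matrix (A × B) (A × B) ℂ) (σ : Matrix B B ℂ)
      (E : Matrix B B ℂ →ₗ[ℂ] Matrix C C ℂ),
      QuantumEntropy.IsState ρ → QuantumEntropy.IsState σ → QuantumEntropy.IsTPCPM E →
      QuantumEntropy.condAlphaEntropy α ρ σ ≤
        QuantumEntropy.condAlphaEntropy α (QuantumEntropy.ampliation A E ρ) (E σ)) ∧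
    -- the von Neumann case for the partial trace over `C`: strong subadditivity
    (∀ ρ : Matrix (A × (B × C)) (A × (B × C)) ℂ, QuantumEntropy.IsState ρ →
      let ρBC : Matrix (B × C) (B × C) ℂ := QuantumEntropy.traceFst A (B × C) ρ
      let ρAB : Matrix (A × B) (A × B) ℂ :=
        QuantumEntropy.ampliation A (QuantumEntropy.traceSnd B C) ρ
      let ρB : Matrix B B ℂ := QuantumEntropy.traceSnd B C ρBC
      QuantumEntropy.condVonNeumann ρ ρBC =
        ((QuantumEntropy.vonNeumannEntropy ρ - QuantumEntropy.vonNeumannEntropy ρBC : ℝ) :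
          EReal) ∧
      QuantumEntropy.condVonNeumann ρAB ρB =
        ((QuantumEntropy.vonNeumannEntropy ρAB - QuantumEntropy.vonNeumannEntropy ρB : ℝ) :
          EReal) ∧
      QuantumEntropy.condVonNeumann ρ ρBC ≤ QuantumEntropy.condVonNeumann ρAB ρB ∧
      QuantumEntropy.vonNeumannEntropy ρ + QuantumEntropy.vonNeumannEntropy ρB ≤
        QuantumEntropy.vonNeumannEntropy ρAB + QuantumEntropy.vonNeumannEntropy ρBC) := by
  refine ⟨fun ρ σ hρ hσ => ⟨fun α h0 h1 => QuantumEntropy.tendsto_alphaEntropyInv hρ hσ h0 h1,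
      QuantumEntropy.tendsto_condAlphaEntropy_zero hρ hσ,
      QuantumEntropy.tendsto_condAlphaEntropy_one hρ hσ,
      QuantumEntropy.tendsto_condVonNeumannInv hρ hσ,
      QuantumEntropy.condAlphaEntropy_one_eq hρ hσ⟩,
    fun α hα ρ σ E hρ hσ hE => QuantumEntropy.condAlphaEntropy_le hE hρ hσ hα.1 hα.2,
    fun ρ hρ => ?_⟩
  intro ρBC ρAB ρB
  have hE : QuantumEntropy.IsTPCPM (QuantumEntropy.traceSnd B C) := QuantumEntropy.isTPCPM_traceSnd
  have hBC : QuantumEntropy.IsState ρBC := QuantumEntropy.isState_traceFst hρ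
  have hAB : QuantumEntropy.IsState ρAB := hE.isState_ampliation hρ
  have hB : QuantumEntropy.IsState ρB := hE.isState_map hBC
  have e1 := QuantumEntropy.condVonNeumann_traceFst hρ
  have e2 := QuantumEntropy.condVonNeumann_traceFst hAB
  rw [QuantumEntropy.traceFst_ampliation_traceSnd] at e2
  have hle : QuantumEntropy.condVonNeumann ρ ρBC ≤ QuantumEntropy.condVonNeumann ρAB ρB := by
    -- Discarding `C` is a channel on the conditioning system, so this is data processing at `α =
    -- 1`.
    rw [← QuantumEntropy.condAlphaEntropy_one_eq hρ hBC,
      ← QuantumEntropy.condAlphaEntropy_one_eq hAB hB]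
    exact QuantumEntropy.condAlphaEntropy_le hE hρ hBC zero_le_one one_le_two
  refine ⟨e1, e2, hle, ?_⟩
  have hle' : QuantumEntropy.vonNeumannEntropy ρ - QuantumEntropy.vonNeumannEntropy ρBC ≤
      QuantumEntropy.vonNeumannEntropy ρAB - QuantumEntropy.vonNeumannEntropy ρB :=
    EReal.coe_le_coe_iff.mp (e1.symm.le.trans (hle.trans e2.le))
  linarith
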